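/- There is an absolute constant $C$ such that the following holds. Let $\mathbb H$ be a real separable Hilbert space and let $\xi,\eta$ be Gaussian random elements of $\mathbb H$, defined on a common probability space, with zero mean and covariance operators $\Sigma_\xi$ and $\Sigma_\eta$. For $\zeta\in\{\xi,\eta\}$ let $\lambda_{1\zeta}\ge\lambda_{2\zeta}\ge\dots\ge 0$ be the eigenvalues of $\Sigma_\zeta$, counted with multiplicity, in non-increasing order and continued by zeros if there are only finitely many positive ones, and put $$\Lambda_{k\zeta}=\Big(\sum_{j\ge k}\lambda_{j\zeta}^2\Big)^{1/2}\quad(k=1,2),\qquad \|\lambda_\xi-\lambda_\eta\|_1=\sum_{j\ge1}|\lambda_{j\xi}-\lambda_{j\eta}|.$$ Let $\|\cdot\|$ denote the operator norm and $\|\cdot\|_{\mathrm{Fr}}$ the Frobenius (Hilbert–Schmidt) norm of operators. The right-hand sides below are read in $[0,\infty]$ with $1/0=\infty$ and $\infty\cdot 0=0$. (i) For every $a\in\mathbb H$, $$\sup_{x>0}\big|P(\|\xi-a\|\le x)-P(\|\eta\|\le x)\big|\le C\left(\frac1{(\Lambda_{1\xi}\Lambda_{2\xi})^{1/2}}+\frac1{(\Lambda_{1\eta}\Lambda_{2\eta})^{1/2}}\right)\big(\|\lambda_\xi-\lambda_\eta\|_1+\|a\|^2\big).$$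 (ii) If moreover $3\|\Sigma_\xi\|^2\le\|\Sigma_\xi\|_{\mathrm{Fr}}^2$ and $3\|\Sigma_\eta\|^2\le\|\Sigma_\eta\|_{\mathrm{Fr}}^2$, then for every $a\in\mathbb H$, $$\sup_{x>0}\big|P(\|\xi-a\|\le x)-P(\|\eta\|\le x)\big|\le C\left(\frac1{\|\Sigma_\xi\|_{\mathrm{Fr}}}+\frac1{\|\Sigma_\eta\|_{\mathrm{Fr}}}\right)\big(\|\lambda_\xi-\lambda_\eta\|_1+\|a\|^2\big).$$ -/

import Mathlib

open MeasureTheory ProbabilityTheory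
open scoped ENNReal NNReal

noncomputable section

namespace GaussianComparison

variable {H : Type*} [NormedAddCommGroup H] [InnerProductSpace ℝ H]

/-- The `k`-th largest eigenvalue `λ_k(T)`, `k = 1, 2, …`, of a compact positive operator `T`:
the eigenvalues are counted with multiplicity, arranged in non-increasing order and, when `T` has
finite rank, continued by zeros. The submodule below is the span of all eigenvectors whose
eigenvalue is at least `c`, so its rank is the number of eigenvalues `≥ c` with multiplicity, and
`λ_k(T)` is the largest `c > 0` for which this number is at least `k` (and `0` if there is none).
The index starts at `1`; the index `0` is never used. -/
def eigenvalue (T : H →L[ℝ] H) (k : ℕ) : ℝ :=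
  sSup {c : ℝ | 0 < c ∧
    (k : Cardinal) ≤
      Module.rank ℝ ↥(⨆ μ ∈ Set.Ici c, Module.End.eigenspace (T : Module.End ℝ H) μ)}

/-- `Λ_k(T) = (∑_{j ≥ k} λ_j(T)²)^{1/2}`. -/
def bigLambda (T : H →L[ℝ] H) (k : ℕ) : ℝ≥0∞ :=
  (∑' j : ℕ, ENNReal.ofReal (eigenvalue T (k + j)) ^ 2) ^ (1 / 2 : ℝ)

/-- `‖λ(S) - λ(T)‖₁ = ∑_{j ≥ 1} |λ_j(S) - λ_j(T)|`: the nuclear norm of the difference of the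
diagonal operators of the ordered eigenvalues. -/
def eigenvalueDist (S T : H →L[ℝ] H) : ℝ≥0∞ :=
  ∑' j : ℕ, ENNReal.ofReal |eigenvalue S (1 + j) - eigenvalue T (1 + j)|

/-- The squared Hilbert–Schmidt norm of `T` computed in the Hilbert basis `b`. -/
def hsSq {ι : Type*} (b : HilbertBasis ι ℝ H) (T : H →L[ℝ] H) : ℝ≥0∞ :=
  ∑' i, ‖T (b i)‖ₑ ^ 2

/-- The Frobenius (Hilbert–Schmidt) norm `‖T‖_Fr = (∑_i ‖T e_i‖²)^{1/2}` for a Hilbert basis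
`(e_i)`; `frobeniusNorm_eq` shows that every Hilbert basis gives the same value. -/
def frobeniusNorm [CompleteSpace H] (T : H →L[ℝ] H) : ℝ≥0∞ :=
  (hsSq (exists_hilbertBasis ℝ H).choose_spec.choose T) ^ (1 / 2 : ℝ)

theorem parseval_enorm {ι : Type*} (b : HilbertBasis ι ℝ H) (x : H) :
    ‖x‖ₑ ^ 2 = ∑' i, ‖(inner ℝ (b i) x : ℝ)‖ₑ ^ 2 := by
  have h : HasSum (fun i => (‖(inner ℝ (b i) x : ℝ)‖ ^ 2 : ℝ)) (‖x‖ ^ 2) := by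
    have h0 := b.hasSum_inner_mul_inner x x
    rw [real_inner_self_eq_norm_sq] at h0
    have e : (fun i => (‖(inner ℝ (b i) x : ℝ)‖ ^ 2 : ℝ)) =
        fun i => (inner ℝ x (b i) : ℝ) * inner ℝ (b i) x := by
      funext i
      rw [real_inner_comm x (b i), Real.norm_eq_abs, sq_abs, sq]
    rw [e]
    exact h0
  rw [← ofReal_norm, ← ENNReal.ofReal_pow (norm_nonneg _), ← h.tsum_eq,
    ENNReal.ofReal_tsum_of_nonneg (fun i => by positivity) h.summable]
  refine tsum_congr fun i => ?_
  rw [← ofReal_norm, ← ENNReal.ofReal_pow (norm_nonneg _)]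

theorem hsSq_eq_adjoint [CompleteSpace H] {ι κ : Type*} (b : HilbertBasis ι ℝ H)
    (d : HilbertBasis κ ℝ H) (T : H →L[ℝ] H) :
    hsSq b T = hsSq d (ContinuousLinearMap.adjoint T) := by
  simp only [hsSq, parseval_enorm d (T _), parseval_enorm b (ContinuousLinearMap.adjoint T _)]
  rw [ENNReal.tsum_comm]
  refine tsum_congr fun j => tsum_congr fun i => ?_
  rw [ContinuousLinearMap.adjoint_inner_right, real_inner_comm]

theorem frobeniusNorm_eq [CompleteSpace H] {ι : Type*} (b : HilbertBasis ι ℝ H)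
    (T : H →L[ℝ] H) : frobeniusNorm T = (∑' i, ‖T (b i)‖ₑ ^ 2) ^ (1 / 2 : ℝ) := by
  rw [frobeniusNorm, hsSq_eq_adjoint _ b, ← hsSq_eq_adjoint b b, hsSq]

end GaussianComparison

end

noncomputable section

namespace GaussianComparison

open Set Measure Filter
open scoped Topology

/-! In an eigenbasis of the covariance, ‖ξ - a‖² is a sum of independent squared Gaussians with
variances λ_j and means -a_j, so its distribution function is a limit of those of finite sums
(`sqLaw`). Shifting a mean or increasing a variance pushes such a sum up stochastically. A square
with mean m is a centred square plus an independent nonnegative variable of mean m²; a centred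
square of variance v + w is a mixture, over m ~ N(0, w), of squares with mean m and variance v.

If a law gives every interval at most M times its length (`Conc`), adding independent nonnegative
noise of mean d lowers its distribution function by at most M d and keeps the concentration bound.
`Dom` records both facts uniformly over all further independent noise; hence it adds up over
coordinates and passes to mixtures. Two spectra are compared through their coordinatewise maximum,
which costs M ‖λ_ξ - λ_η‖₁, and the shift costs M ‖a‖².

It remains to bound M by a multiple of (Λ₁Λ₂)^(-1/2), in `eventually_conc_sqLaw`. If no λ_j² exceeds
Λ₁²/3, the characteristic function is integrable, with integral of order 1/Λ₁. If λ₁ is comparable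
to Λ₁ but the remaining sequence is balanced, the Fourier bound of order 1/Λ₂ for the tail is
combined with the density of the first square. If also λ₂ is comparable to Λ₂, the first two squares
suffice, by the area of an annulus. Under the hypothesis of (ii), Λ₂ is comparable to Λ₁, so (ii)
follows from (i). -/

theorem conv_apply_eq_lintegral (μ β : Measure ℝ) [SFinite μ] [SFinite β] {A : Set ℝ}
    (hA : MeasurableSet A) : (μ ∗ β) A = ∫⁻ b, μ ((fun y => y + b) ⁻¹' A) ∂β := by
  rw [conv_comm, ← lintegral_indicator_one hA, lintegral_conv (by measurability)]
  refine lintegral_congr fun b => ?_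
  rw [← lintegral_indicator_one (hA.preimage (measurable_add_const b))]
  refine lintegral_congr fun y => ?_
  rw [add_comm]
  rfl

theorem conv_Iic (μ β : Measure ℝ) [SFinite μ] [SFinite β] (x : ℝ) :
    (μ ∗ β) (Iic x) = ∫⁻ b, μ (Iic (x - b)) ∂β := by
  rw [conv_apply_eq_lintegral _ _ measurableSet_Iic]
  simp

theorem conv_Ioc (μ β : Measure ℝ) [SFinite μ] [SFinite β] (s t : ℝ) :
    (μ ∗ β) (Ioc s t) = ∫⁻ b, μ (Ioc (s - b) (t - b)) ∂β := by
  rw [conv_apply_eq_lintegral _ _ measurableSet_Ioc]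
  simp

theorem measurable_measure_Iic_sub (μ : Measure ℝ) [SFinite μ] (x : ℝ) :
    Measurable fun b => μ (Iic (x - b)) := by
  have h : Antitone fun b => μ (Iic (x - b)) := fun a b hab =>
    measure_mono (Iic_subset_Iic.2 (by linarith))
  exact h.measurable

/-! ### Concentration, and stochastic domination stable under convolution -/

/-- The measure `μ` has concentration function at most `M` times the length of the interval. -/
def Conc (μ : Measure ℝ) (M : ℝ≥0∞) : Prop :=
  ∀ s t : ℝ, s ≤ t → μ (Ioc s t) ≤ M * ENNReal.ofReal (t - s)

theorem Conc.mono {μ : Measure ℝ} {M N : ℝ≥0∞} (h : Conc μ M) (hMN : M ≤ N) : Conc μ N :=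
  fun s t hst => (h s t hst).trans (by gcongr)

theorem Conc.conv {μ : Measure ℝ} [SFinite μ] {M : ℝ≥0∞} (h : Conc μ M) (β : Measure ℝ)
    [IsProbabilityMeasure β] : Conc (μ ∗ β) M := by
  intro s t hst
  rw [conv_Ioc]
  calc ∫⁻ b, μ (Ioc (s - b) (t - b)) ∂β ≤ ∫⁻ _, M * ENNReal.ofReal (t - s) ∂β := by
        refine lintegral_mono fun b => (h _ _ (by linarith)).trans_eq ?_
        congr 2; ring
    _ = _ := by simp

theorem Conc.Iic_le {μ : Measure ℝ} {M : ℝ≥0∞} (h : Conc μ M) {x w : ℝ} (hw : 0 ≤ w) :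
    μ (Iic x) ≤ μ (Iic (x - w)) + M * ENNReal.ofReal w := by
  have e : Iic x = Iic (x - w) ∪ Ioc (x - w) x := (Iic_union_Ioc_eq_Iic (by linarith)).symm
  rw [e]
  refine (measure_union_le _ _).trans ?_
  gcongr
  simpa using h (x - w) x (by linarith)

/-- `ν` dominates `μ` stochastically with mean excess at most `d`, stably under convolution: for
every independent noise, concentration bounds are inherited and the distribution functions differ
by at most the concentration constant times `d`. -/
def Dom (μ ν : Measure ℝ) (d : ℝ≥0∞) : Prop :=
  ∀ (β : Measure ℝ) [IsProbabilityMeasure β] (M : ℝ≥0∞), Conc (μ ∗ β) M →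
    Conc (ν ∗ β) M ∧
      ∀ x, (ν ∗ β) (Iic x) ≤ (μ ∗ β) (Iic x) ∧ (μ ∗ β) (Iic x) ≤ (ν ∗ β) (Iic x) + M * d

theorem Dom.refl (μ : Measure ℝ) : Dom μ μ 0 := fun _ _ _ h => ⟨h, fun _ => ⟨le_rfl, by simp⟩⟩

theorem Dom.trans {μ ν κ : Measure ℝ} {d e : ℝ≥0∞} (h₁ : Dom μ ν d) (h₂ : Dom ν κ e) :
    Dom μ κ (d + e) := by
  intro β _ M hM
  obtain ⟨hν, h1⟩ := h₁ β M hM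
  obtain ⟨hκ, h2⟩ := h₂ β M hν
  refine ⟨hκ, fun x => ⟨(h2 x).1.trans (h1 x).1, (h1 x).2.trans ?_⟩⟩
  rw [mul_add, add_comm (M * d), ← add_assoc]
  gcongr
  exact (h2 x).2

theorem Dom.conv_left {μ ν : Measure ℝ} {d : ℝ≥0∞} (h : Dom μ ν d)
    (γ : Measure ℝ) [IsProbabilityMeasure γ] : Dom (μ ∗ γ) (ν ∗ γ) d := by
  intro β _ M hM
  rw [conv_assoc] at hM ⊢
  rw [conv_assoc]
  exact h (γ ∗ β) M hM

/-- Replace one factor at a time, treating the other as part of the noise; this is why `Dom`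
quantifies over all noise laws. -/
theorem Dom.conv {μ ν μ' ν' : Measure ℝ} [IsProbabilityMeasure μ'] [IsProbabilityMeasure ν]
    [IsProbabilityMeasure ν'] {d d' : ℝ≥0∞} (h : Dom μ ν d) [IsProbabilityMeasure μ]
    (h' : Dom μ' ν' d') : Dom (μ ∗ μ') (ν ∗ ν') (d + d') := by
  refine (h.conv_left μ').trans ?_
  rw [conv_comm ν, conv_comm ν]
  exact h'.conv_left ν

theorem Dom.apply {μ ν : Measure ℝ} [SFinite μ] [SFinite ν] {d : ℝ≥0∞} (h : Dom μ ν d) {M : ℝ≥0∞}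
    (hM : Conc μ M) :
    Conc ν M ∧ ∀ x, ν (Iic x) ≤ μ (Iic x) ∧ μ (Iic x) ≤ ν (Iic x) + M * d := by
  simpa using h (dirac 0) M (by simpa using hM)

/-- Condition on the added variable w ≥ 0: the threshold moves from x to x - w, which costs at most
M w. Integrate over w. -/
theorem Dom.of_conv (μ ρ : Measure ℝ) [IsProbabilityMeasure μ] [IsProbabilityMeasure ρ]
    (h0 : ∀ᵐ w ∂ρ, 0 ≤ w) {d : ℝ≥0∞} (hd : ∫⁻ w, ENNReal.ofReal w ∂ρ ≤ d) :
    Dom μ (μ ∗ ρ) d := by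
  intro β _ M hM
  have e : μ ∗ ρ ∗ β = μ ∗ β ∗ ρ := by
    rw [conv_comm ρ β]
  rw [conv_assoc, e, ← conv_assoc]
  have : IsProbabilityMeasure (μ ∗ β) := inferInstance
  generalize μ ∗ β = κ at hM this ⊢
  refine ⟨hM.conv ρ, fun x => ?_⟩
  rw [conv_Iic]
  constructor
  · calc ∫⁻ w, κ (Iic (x - w)) ∂ρ ≤ ∫⁻ _, κ (Iic x) ∂ρ := by
          refine lintegral_mono_ae ?_
          filter_upwards [h0] with w hw
          exact measure_mono (Iic_subset_Iic.2 (by linarith))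
      _ = κ (Iic x) := by simp
  · calc κ (Iic x) = ∫⁻ _, κ (Iic x) ∂ρ := by simp
      _ ≤ ∫⁻ w, (κ (Iic (x - w)) + M * ENNReal.ofReal w) ∂ρ := by
          refine lintegral_mono_ae ?_
          filter_upwards [h0] with w hw
          exact hM.Iic_le hw
      _ = ∫⁻ w, κ (Iic (x - w)) ∂ρ + M * ∫⁻ w, ENNReal.ofReal w ∂ρ := by
          rw [lintegral_add_left (measurable_measure_Iic_sub κ x),
            lintegral_const_mul _ ENNReal.measurable_ofReal]
      _ ≤ _ := by gcongr

/-! ### Squares of Gaussian variables and their characteristic functions -/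

/-- The law of the square of a real Gaussian variable. -/
def sqGauss (m : ℝ) (v : ℝ≥0) : Measure ℝ := (gaussianReal m v).map fun y => y ^ 2

instance (m : ℝ) (v : ℝ≥0) : IsProbabilityMeasure (sqGauss m v) :=
  isProbabilityMeasure_map (by fun_prop)

theorem sqGauss_zero (m : ℝ) : sqGauss m 0 = dirac (m ^ 2) := by
  rw [sqGauss, gaussianReal_zero_var, map_dirac' (by fun_prop)]

theorem ae_nonneg_sqGauss (m : ℝ) (v : ℝ≥0) : ∀ᵐ y ∂sqGauss m v, 0 ≤ y := by
  rw [sqGauss, ae_map_iff (by fun_prop) measurableSet_Ici]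
  exact ae_of_all _ fun y => sq_nonneg y

theorem lintegral_sqGauss (m : ℝ) (v : ℝ≥0) :
    ∫⁻ y, ENNReal.ofReal y ∂sqGauss m v = ENNReal.ofReal (m ^ 2) + v := by
  rw [sqGauss, lintegral_map (by fun_prop) (by fun_prop)]
  have h2 : MemLp id 2 (gaussianReal m v) := memLp_id_gaussianReal 2
  have hi : Integrable (fun y : ℝ => y ^ 2) (gaussianReal m v) := h2.integrable_sq
  rw [← ofReal_integral_eq_lintegral_ofReal hi (ae_of_all _ fun y => sq_nonneg _)]
  have := variance_eq_sub h2
  simp only [Pi.pow_apply, id, variance_id_gaussianReal, integral_id_gaussianReal] at this ⊢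
  rw [show ∫ y, y ^ 2 ∂gaussianReal m v = m ^ 2 + v by linarith,
    ENNReal.ofReal_add (sq_nonneg _) v.coe_nonneg, ENNReal.ofReal_coe_nnreal]

theorem charFun_sqGauss_eq (m : ℝ) {v : ℝ≥0} (hv : v ≠ 0) (t : ℝ) :
    charFun (sqGauss m v) t = ((√(2 * Real.pi * v))⁻¹ : ℝ) *
      (Real.pi / -(t * Complex.I - (2 * v : ℂ)⁻¹)) ^ (1 / 2 : ℂ) *
      Complex.exp (t * m ^ 2 * Complex.I / (1 - 2 * v * t * Complex.I)) := by
  have hv' : (0 : ℝ) < v := by positivity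
  have hvC : (v : ℂ) ≠ 0 := by exact_mod_cast hv
  have hn : (1 - 2 * v * t * Complex.I : ℂ) ≠ 0 := by
    intro h
    have := congrArg Complex.re h
    simp at this
  have hn' : (t * Complex.I - (2 * v : ℂ)⁻¹) ≠ 0 := by
    intro h
    apply hn
    field_simp at h
    linear_combination -h
  rw [charFun_apply_real, sqGauss, integral_map (by fun_prop) (by fun_prop),
    integral_gaussianReal_eq_integral_smul hv]
  calc ∫ y : ℝ, gaussianPDFReal m v y • Complex.exp (t * (y ^ 2 : ℝ) * Complex.I)
      = ((√(2 * Real.pi * v))⁻¹ : ℝ) * ∫ y : ℝ, Complex.exp ((t * Complex.I - (2 * v : ℂ)⁻¹) * y ^ 2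
          + (m / v) * y + -m ^ 2 / (2 * v)) := by
        rw [← integral_const_mul]
        congr with y
        rw [gaussianPDFReal, Complex.real_smul]
        push_cast
        rw [mul_assoc, ← Complex.exp_add]
        congr 2
        field_simp
        ring
    _ = _ := by
        rw [integral_cexp_quadratic (by
          have : ((2 * (v : ℂ))⁻¹).re = (2 * (v : ℝ))⁻¹ := by
            rw [← Complex.ofReal_re (2 * (v : ℝ))⁻¹]; push_cast; rfl
          simp only [Complex.sub_re, this]
          simp
          positivity), ← mul_assoc]
        congr 2
        have e : (t * Complex.I - (2 * v : ℂ)⁻¹) = -(1 - 2 * v * t * Complex.I) / (2 * v) := by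
          field_simp; ring
        rw [e]
        field_simp
        ring

theorem charFun_sqGauss (m : ℝ) {v : ℝ≥0} (hv : v ≠ 0) (t : ℝ) :
    charFun (sqGauss m v) t = charFun (sqGauss 0 v) t *
      Complex.exp (t * m ^ 2 * Complex.I / (1 - 2 * v * t * Complex.I)) := by
  rw [charFun_sqGauss_eq m hv, charFun_sqGauss_eq 0 hv]
  simp

/-- Squaring removes the branch of the complex square root. Only this square is needed for the
Poisson mixture, whose components have even numbers of degrees of freedom, and for the modulus. -/
theorem charFun_sqGauss_zero_sq {v : ℝ≥0} (hv : v ≠ 0) (t : ℝ) :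
    charFun (sqGauss 0 v) t ^ 2 = (1 - 2 * v * t * Complex.I)⁻¹ := by
  have hvC : (v : ℂ) ≠ 0 := by exact_mod_cast hv
  have hpi : (Real.pi : ℂ) ≠ 0 := by exact_mod_cast Real.pi_ne_zero
  have hn : (1 - 2 * v * t * Complex.I : ℂ) ≠ 0 := by
    intro h
    have := congrArg Complex.re h
    simp at this
  rw [charFun_sqGauss_eq 0 hv, mul_pow, mul_pow, ← Complex.ofReal_pow, inv_pow,
    Real.sq_sqrt (by positivity), ← Complex.cpow_nat_mul]
  have e : (t * Complex.I - (2 * v : ℂ)⁻¹) = -(1 - 2 * v * t * Complex.I) / (2 * v) := by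
    field_simp; ring
  rw [e, neg_div, neg_neg]
  simp
  field_simp

theorem norm_charFun_sqGauss (v : ℝ≥0) (t : ℝ) :
    ‖charFun (sqGauss 0 v) t‖ = (1 + 4 * t ^ 2 * v ^ 2) ^ (-(1 / 4) : ℝ) := by
  rcases eq_or_ne v 0 with rfl | hv
  · simp [sqGauss_zero]
  have h := congrArg (fun z : ℂ => ‖z‖ ^ 2) (charFun_sqGauss_zero_sq hv t)
  simp only [norm_pow, norm_inv, inv_pow] at h
  have e : ‖(1 - 2 * v * t * Complex.I : ℂ)‖ ^ 2 = 1 + 4 * t ^ 2 * v ^ 2 := by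
    rw [← Complex.normSq_eq_norm_sq, Complex.normSq_apply]
    simp
    ring
  rw [e, ← pow_mul] at h
  rw [Real.rpow_neg (by positivity), ← Real.inv_rpow (by positivity), ← h, ← Real.rpow_natCast,
    ← Real.rpow_mul (norm_nonneg _)]
  norm_num

/-! ### Finite sums of independent squares -/

/-- The law of `∑_{i ∈ s} y_i²` for independent Gaussian variables `y_i`. -/
def sqLaw {ι : Type*} (s : Finset ι) (m : ι → ℝ) (v : ι → ℝ≥0) : Measure ℝ :=
  (infinitePi fun i => gaussianReal (m i) (v i)).map fun y => ∑ i ∈ s, y i ^ 2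

section sqLaw

variable {ι : Type*}

instance (s : Finset ι) (m : ι → ℝ) (v : ι → ℝ≥0) : IsProbabilityMeasure (sqLaw s m v) :=
  isProbabilityMeasure_map (Measurable.aemeasurable (by fun_prop))

theorem charFun_map_sum_sq {Ω : Type*} [MeasurableSpace Ω] {P : Measure Ω} {Y : ι → Ω → ℝ}
    {m : ι → ℝ} {v : ι → ℝ≥0} (s : Finset ι) (hY : iIndepFun (s.restrict Y) P)
    (hm : ∀ i ∈ s, AEMeasurable (Y i) P) (h : ∀ i ∈ s, P.map (Y i) = gaussianReal (m i) (v i))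
    (t : ℝ) :
    charFun (P.map fun ω => ∑ i ∈ s, Y i ω ^ 2) t = ∏ i ∈ s, charFun (sqGauss (m i) (v i)) t := by
  have h1 := iIndepFun.charFun_map_fun_finsetSum_eq_prod (P := P) (s := s)
    (X := fun i ω => Y i ω ^ 2) (fun i hi => (hm i hi).pow_const 2)
    (hY.comp (fun _ y => y ^ 2) fun _ => by fun_prop)
  rw [h1, Finset.prod_apply]
  refine Finset.prod_congr rfl fun i hi => ?_
  rw [sqGauss, ← h i hi, AEMeasurable.map_map_of_aemeasurable (by fun_prop) (hm i hi)]
  rfl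

theorem charFun_sqLaw (s : Finset ι) (m : ι → ℝ) (v : ι → ℝ≥0) (t : ℝ) :
    charFun (sqLaw s m v) t = ∏ i ∈ s, charFun (sqGauss (m i) (v i)) t := by
  refine charFun_map_sum_sq s ?_ (fun i _ => (measurable_pi_apply i).aemeasurable) (fun i _ => ?_) t
  · exact (iIndepFun_infinitePi (X := fun _ y => y) fun _ => measurable_id).restrict _
  · exact infinitePi_map_eval _ i

theorem sqLaw_empty (m : ι → ℝ) (v : ι → ℝ≥0) : sqLaw ∅ m v = dirac 0 := by
  simp [sqLaw]

theorem sqLaw_disjUnion {s t : Finset ι} (h : Disjoint s t) (m : ι → ℝ) (v : ι → ℝ≥0) :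
    sqLaw (s.disjUnion t h) m v = sqLaw s m v ∗ sqLaw t m v := by
  refine ext_of_charFun (funext fun x => ?_)
  rw [charFun_conv, charFun_sqLaw, charFun_sqLaw, charFun_sqLaw, Finset.prod_disjUnion]

theorem sqLaw_insert [DecidableEq ι] {s : Finset ι} {i : ι} (h : i ∉ s) (m : ι → ℝ)
    (v : ι → ℝ≥0) : sqLaw (insert i s) m v = sqGauss (m i) (v i) ∗ sqLaw s m v := by
  refine ext_of_charFun (funext fun x => ?_)
  rw [charFun_conv, charFun_sqLaw, charFun_sqLaw, Finset.prod_insert h]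

theorem sqLaw_union_of_zero [DecidableEq ι] {s u : Finset ι} {m : ι → ℝ} {v : ι → ℝ≥0}
    (hm : ∀ i ∈ u, m i = 0) (hv : ∀ i ∈ u, v i = 0) : sqLaw (s ∪ u) m v = sqLaw s m v := by
  refine ext_of_charFun (funext fun x => ?_)
  rw [charFun_sqLaw, charFun_sqLaw]
  refine (Finset.prod_subset Finset.subset_union_left fun i hi his => ?_).symm
  have hu : i ∈ u := by simpa [his] using hi
  simp [hm i hu, hv i hu, sqGauss_zero]

theorem sqLaw_map {κ : Type*} (e : κ ↪ ι) (s : Finset κ) (m : ι → ℝ) (v : ι → ℝ≥0) :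
    sqLaw (s.map e) m v = sqLaw s (m ∘ e) (v ∘ e) := by
  refine ext_of_charFun (funext fun x => ?_)
  simp [charFun_sqLaw]

theorem ae_nonneg_sqLaw (s : Finset ι) (m : ι → ℝ) (v : ι → ℝ≥0) : ∀ᵐ y ∂sqLaw s m v, 0 ≤ y := by
  rw [sqLaw, ae_map_iff (Measurable.aemeasurable (by fun_prop)) measurableSet_Ici]
  exact ae_of_all _ fun y => Finset.sum_nonneg fun i _ => sq_nonneg _

theorem Dom.sqLaw {s : Finset ι} {m m' : ι → ℝ} {v v' : ι → ℝ≥0} {d : ι → ℝ≥0∞}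
    (h : ∀ i ∈ s, Dom (sqGauss (m i) (v i)) (sqGauss (m' i) (v' i)) (d i)) :
    Dom (sqLaw s m v) (sqLaw s m' v') (∑ i ∈ s, d i) := by
  classical
  induction s using Finset.induction_on with
  | empty => simpa [sqLaw_empty] using Dom.refl (dirac 0)
  | insert i s hi ih =>
    rw [sqLaw_insert hi, sqLaw_insert hi, Finset.sum_insert hi]
    exact (h i (by simp)).conv (ih fun j hj => h j (by simp [hj]))

end sqLaw

/-! ### Monotonicity in the mean and in the variance -/

/-- The Poisson mixture with parameter `r` of the laws of `v` times a chi-squared variable with an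
even number of degrees of freedom. -/
def poissonMix (r : ℝ) (v : ℝ≥0) : Measure ℝ :=
  Measure.sum fun n : ℕ => ENNReal.ofReal (Real.exp (-r) * (r ^ n / n.factorial)) •
    sqLaw (Finset.range (2 * n)) (fun _ => 0) fun _ => v

theorem hasSum_poisson_weights (r : ℝ) :
    HasSum (fun n : ℕ => Real.exp (-r) * (r ^ n / n.factorial)) 1 := by
  have := (NormedSpace.expSeries_div_hasSum_exp r).mul_left (Real.exp (-r))
  rwa [← Real.exp_eq_exp_ℝ, ← Real.exp_add, neg_add_cancel, Real.exp_zero] at this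

theorem isProbabilityMeasure_poissonMix {r : ℝ} (hr : 0 ≤ r) (v : ℝ≥0) :
    IsProbabilityMeasure (poissonMix r v) := by
  constructor
  have h := hasSum_poisson_weights r
  rw [poissonMix, Measure.sum_apply _ MeasurableSet.univ]
  simp only [Measure.smul_apply, measure_univ, smul_eq_mul, mul_one]
  rw [← ENNReal.ofReal_tsum_of_nonneg (fun n => by positivity) h.summable, h.tsum_eq,
    ENNReal.ofReal_one]

theorem ae_nonneg_poissonMix (r : ℝ) (v : ℝ≥0) : ∀ᵐ y ∂poissonMix r v, 0 ≤ y := by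
  rw [poissonMix, Measure.ae_sum_iff]
  exact fun n => Measure.ae_smul_measure (ae_nonneg_sqLaw _ _ _) _

theorem charFun_poissonMix {r : ℝ} (hr : 0 ≤ r) {v : ℝ≥0} (hv : v ≠ 0) (t : ℝ) :
    charFun (poissonMix r v) t =
      Complex.exp (-r + r * (1 - 2 * v * t * Complex.I)⁻¹) := by
  have := isProbabilityMeasure_poissonMix hr v
  set z : ℂ := (1 - 2 * v * t * Complex.I)⁻¹ with hz
  have hi : Integrable (fun x : ℝ => Complex.exp (t * x * Complex.I)) (poissonMix r v) := by
    refine (integrable_const (1 : ℝ)).mono' (by fun_prop) (ae_of_all _ fun x => ?_)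
    rw [← Complex.ofReal_mul, Complex.norm_exp_ofReal_mul_I]
  have h1 := hasSum_integral_measure hi
  rw [← poissonMix, ← charFun_apply_real] at h1
  have h2 := (NormedSpace.expSeries_div_hasSum_exp ((r : ℂ) * z)).mul_left (Complex.exp (-r))
  rw [← Complex.exp_eq_exp_ℂ, ← Complex.exp_add] at h2
  refine h1.unique (h2.congr_fun fun n => ?_)
  rw [integral_smul_measure, ← charFun_apply_real, charFun_sqLaw, Finset.prod_const,
    Finset.card_range, pow_mul, charFun_sqGauss_zero_sq hv, ← hz,
    ENNReal.toReal_ofReal (by positivity), Complex.real_smul]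
  push_cast
  ring

/-- The noncentral chi-squared law is the central one convolved with a Poisson mixture of parameter
m²/(2v). With D = 1 - 2ivt this is the identity itm²/D = (m²/(2v))(1/D - 1) between exponents. -/
theorem Dom.sqGauss_shift (m : ℝ) (v : ℝ≥0) :
    Dom (sqGauss 0 v) (sqGauss m v) (ENNReal.ofReal (m ^ 2)) := by
  rcases eq_or_ne v 0 with rfl | hv
  · have := Dom.of_conv (sqGauss 0 0) (dirac (m ^ 2)) (d := ENNReal.ofReal (m ^ 2))
      (by rw [ae_dirac_iff measurableSet_Ici]; positivity) (by simp)
    simpa [sqGauss_zero, dirac_conv_dirac] using this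
  have hr : 0 ≤ m ^ 2 / (2 * v) := by positivity
  have := isProbabilityMeasure_poissonMix hr v
  have e : sqGauss m v = sqGauss 0 v ∗ poissonMix (m ^ 2 / (2 * v)) v := by
    refine ext_of_charFun (funext fun t => ?_)
    have hvC : (v : ℂ) ≠ 0 := by exact_mod_cast hv
    have hn : (1 - 2 * v * t * Complex.I : ℂ) ≠ 0 := by
      intro h
      have := congrArg Complex.re h
      simp at this
    rw [charFun_conv, charFun_sqGauss m hv, charFun_poissonMix hr hv]
    congr 2
    generalize hD : (1 - 2 * v * t * Complex.I : ℂ) = D at hn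
    have h1 : t * m ^ 2 * Complex.I = m ^ 2 * ((1 - D) / (2 * v)) := by
      rw [← hD]
      field_simp
      ring
    rw [h1]
    push_cast
    field_simp
    ring
  -- The mean of the mixture comes from comparing means in `e`: (m² + v) - v = m².
  have hd : ∫⁻ y, ENNReal.ofReal y ∂poissonMix (m ^ 2 / (2 * v)) v = ENNReal.ofReal (m ^ 2) := by
    have h1 := lintegral_sqGauss m v
    have h0 := lintegral_sqGauss 0 v
    rw [e, conv_comm, lintegral_conv ENNReal.measurable_ofReal] at h1
    have h2 : ∫⁻ x, ∫⁻ y, ENNReal.ofReal (x + y) ∂sqGauss 0 v ∂poissonMix (m ^ 2 / (2 * v)) v =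
        ∫⁻ x, (ENNReal.ofReal x + v) ∂poissonMix (m ^ 2 / (2 * v)) v := by
      refine lintegral_congr_ae ?_
      filter_upwards [ae_nonneg_poissonMix (m ^ 2 / (2 * v)) v] with x hx
      have : ∫⁻ y, ENNReal.ofReal (x + y) ∂sqGauss 0 v =
          ∫⁻ y, (ENNReal.ofReal x + ENNReal.ofReal y) ∂sqGauss 0 v := by
        refine lintegral_congr_ae ?_
        filter_upwards [ae_nonneg_sqGauss 0 v] with y hy
        exact ENNReal.ofReal_add hx hy
      rw [this, lintegral_add_right _ ENNReal.measurable_ofReal, h0]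
      simp
    rw [h2, lintegral_add_right _ measurable_const] at h1
    simpa using h1
  rw [e]
  exact Dom.of_conv _ _ (ae_nonneg_poissonMix _ _) hd.le

theorem sqGauss_conv_apply_eq_lintegral (v w : ℝ≥0) (β : Measure ℝ) [IsProbabilityMeasure β]
    {A : Set ℝ} (hA : MeasurableSet A) :
    (sqGauss 0 (v + w) ∗ β) A = ∫⁻ m, (sqGauss m v ∗ β) A ∂gaussianReal 0 w := by
  have h (m : ℝ) (u : ℝ≥0) : (sqGauss m u ∗ β) A =
      ∫⁻ y, β ((fun b => y ^ 2 + b) ⁻¹' A) ∂gaussianReal m u := by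
    have hm : Measurable fun x => β ((fun b => x + b) ⁻¹' A) := by
      exact measurable_measure_prodMk_left (measurable_add hA)
    rw [conv_comm, conv_apply_eq_lintegral _ _ hA, sqGauss]
    have hc (x : ℝ) : (fun b => b + x) ⁻¹' A = (fun b => x + b) ⁻¹' A := by simp_rw [add_comm]
    simp_rw [hc]
    rw [lintegral_map hm (by fun_prop)]
  have hm2 : Measurable fun x : ℝ => β ((fun b => x ^ 2 + b) ⁻¹' A) := by
    have hm : Measurable fun x => β ((fun b => x + b) ⁻¹' A) := by
      exact measurable_measure_prodMk_left (measurable_add hA)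
    exact hm.comp (by fun_prop)
  simp_rw [h]
  rw [add_comm v w, show (0 : ℝ) = 0 + 0 by simp, ← gaussianReal_conv_gaussianReal,
    lintegral_conv hm2]
  simp only [add_zero]
  refine lintegral_congr fun m => ?_
  rw [← lintegral_map (f := fun x : ℝ => β ((fun b => x ^ 2 + b) ⁻¹' A)) hm2 (measurable_const_add m),
    gaussianReal_map_const_add, zero_add]

/-- Since N(0, v + w) is the mixture of N(m, v) over m ~ N(0, w), the bounds of `Dom.sqGauss_shift`
can be averaged over m with the same M; the mean of m² is w. -/
theorem Dom.sqGauss_scale (v w : ℝ≥0) : Dom (sqGauss 0 v) (sqGauss 0 (v + w)) w := by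
  intro β _ M hM
  have hs (m : ℝ) := Dom.sqGauss_shift m v β M hM
  refine ⟨fun s t hst => ?_, fun x => ?_⟩
  · rw [sqGauss_conv_apply_eq_lintegral v w β measurableSet_Ioc]
    calc ∫⁻ m, (sqGauss m v ∗ β) (Ioc s t) ∂gaussianReal 0 w
        ≤ ∫⁻ _, M * ENNReal.ofReal (t - s) ∂gaussianReal 0 w :=
          lintegral_mono fun m => (hs m).1 s t hst
      _ = _ := by simp
  rw [sqGauss_conv_apply_eq_lintegral v w β measurableSet_Iic]
  constructor
  · calc ∫⁻ m, (sqGauss m v ∗ β) (Iic x) ∂gaussianReal 0 w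
        ≤ ∫⁻ _, (sqGauss 0 v ∗ β) (Iic x) ∂gaussianReal 0 w :=
          lintegral_mono fun m => ((hs m).2 x).1
      _ = _ := by simp
  · have hw : ∫⁻ m, ENNReal.ofReal (m ^ 2) ∂gaussianReal 0 w = w := by
      have := lintegral_sqGauss 0 w
      rw [sqGauss, lintegral_map (by fun_prop) (by fun_prop)] at this
      simpa using this
    calc (sqGauss 0 v ∗ β) (Iic x) = ∫⁻ _, (sqGauss 0 v ∗ β) (Iic x) ∂gaussianReal 0 w := by simp
      _ ≤ ∫⁻ m, ((sqGauss m v ∗ β) (Iic x) + M * ENNReal.ofReal (m ^ 2)) ∂gaussianReal 0 w :=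
          lintegral_mono fun m => ((hs m).2 x).2
      _ = _ := by
          rw [lintegral_add_right _ (by fun_prop), lintegral_const_mul _ (by fun_prop), hw]

/-! ### Concentration from one or two large squares -/

theorem Conc.conv_finite {μ : Measure ℝ} [SFinite μ] {M : ℝ≥0∞} (h : Conc μ M) (β : Measure ℝ)
    [IsFiniteMeasure β] : Conc (μ ∗ β) (M * β univ) := by
  intro s t hst
  rw [conv_Ioc]
  calc ∫⁻ b, μ (Ioc (s - b) (t - b)) ∂β ≤ ∫⁻ _, M * ENNReal.ofReal (t - s) ∂β := by
        refine lintegral_mono fun b => (h _ _ (by linarith)).trans_eq ?_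
        congr 2; ring
    _ = _ := by rw [lintegral_const]; ring

theorem Conc.add {μ ν : Measure ℝ} {M N : ℝ≥0∞} (hμ : Conc μ M) (hν : Conc ν N) :
    Conc (μ + ν) (M + N) := by
  intro s t hst
  rw [Measure.add_apply, add_mul]
  exact add_le_add (hμ s t hst) (hν s t hst)

theorem gaussianReal_le_smul_volume (m : ℝ) {v : ℝ≥0} (hv : v ≠ 0) :
    gaussianReal m v ≤ ENNReal.ofReal (√(2 * Real.pi * v))⁻¹ • (volume : Measure ℝ) := by
  rw [Measure.le_iff]
  intro A hA
  rw [gaussianReal_apply _ hv, Measure.smul_apply, smul_eq_mul, ← setLIntegral_const]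
  refine lintegral_mono fun x => ENNReal.ofReal_le_ofReal ?_
  rw [gaussianPDFReal]
  refine mul_le_of_le_one_right (by positivity) (Real.exp_le_one_iff.2 ?_)
  rw [neg_div, neg_nonpos]
  positivity

theorem sqGauss_Iio_le {v : ℝ≥0} (hv : v ≠ 0) (δ : ℝ) :
    sqGauss 0 v (Iio δ) ≤ ENNReal.ofReal (2 * √δ / √(2 * Real.pi * v)) := by
  rw [sqGauss, Measure.map_apply (by fun_prop) measurableSet_Iio]
  calc gaussianReal 0 v ((fun y => y ^ 2) ⁻¹' Iio δ) ≤ gaussianReal 0 v (Ioo (-√δ) (√δ)) := by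
        refine measure_mono fun y hy => ?_
        exact abs_lt.1 (Real.lt_sqrt (abs_nonneg y) |>.2 (by simpa using hy))
    _ ≤ _ := gaussianReal_le_smul_volume 0 hv _
    _ = _ := by
        rw [Measure.smul_apply, Real.volume_Ioo, smul_eq_mul, ← ENNReal.ofReal_mul (by positivity)]
        congr 1
        ring

/-- Away from the origin the square root is Lipschitz: above δ an interval of length t - s pulls
back to two intervals of length at most (t - s)/(2√δ). -/
theorem conc_sqGauss_restrict_Ici {v : ℝ≥0} (hv : v ≠ 0) {δ : ℝ} (hδ : 0 < δ) :
    Conc ((sqGauss 0 v).restrict (Ici δ)) (ENNReal.ofReal (1 / (√δ * √(2 * Real.pi * v)))) := by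
  intro s t hst
  rw [Measure.restrict_apply measurableSet_Ioc, sqGauss,
    Measure.map_apply (by fun_prop) (measurableSet_Ioc.inter measurableSet_Ici)]
  rcases lt_or_ge t (max s δ) with h | h
  · have : (fun y : ℝ => y ^ 2) ⁻¹' (Ioc s t ∩ Ici δ) = ∅ := by
      ext y
      simp only [mem_preimage, mem_inter_iff, mem_Ioc, mem_Ici, mem_empty_iff_false, iff_false]
      rintro ⟨⟨h1, h2⟩, h3⟩
      exact absurd (max_le h1.le h3) (by linarith)
    rw [this]
    simp
  set r := max s δ with hr
  have hr0 : 0 < r := hδ.trans_le (le_max_right _ _)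
  have h1 : 0 < √δ := Real.sqrt_pos.2 hδ
  have h2 : √δ ≤ √r := Real.sqrt_le_sqrt (le_max_right _ _)
  have h3 : √r ≤ √t := Real.sqrt_le_sqrt h
  have h4 : √t - √r ≤ (t - s) / (2 * √δ) := by
    rw [le_div_iff₀ (by positivity)]
    have e1 := Real.sq_sqrt hr0.le
    have e2 := Real.sq_sqrt (hr0.le.trans h)
    have e3 : s ≤ r := le_max_left _ _
    nlinarith
  calc gaussianReal 0 v ((fun y => y ^ 2) ⁻¹' (Ioc s t ∩ Ici δ))
      ≤ gaussianReal 0 v (Icc (√r) (√t) ∪ Icc (-√t) (-√r)) := by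
        refine measure_mono fun y hy => ?_
        obtain ⟨⟨hy1, hy2⟩, hy3⟩ := hy
        simp only at hy1 hy2 hy3
        have a1 : |y| ≤ √t := Real.le_sqrt (abs_nonneg y) (hr0.le.trans h) |>.2 (by simpa using hy2)
        have a2 : √r ≤ |y| := by
          rw [Real.sqrt_le_left (abs_nonneg y), sq_abs]
          exact max_le hy1.le hy3
        rcases le_total 0 y with h0 | h0
        · rw [abs_of_nonneg h0] at a1 a2
          exact Or.inl ⟨a2, a1⟩
        · rw [abs_of_nonpos h0] at a1 a2
          exact Or.inr ⟨by linarith, by linarith⟩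
    _ ≤ _ := gaussianReal_le_smul_volume 0 hv _
    _ ≤ ENNReal.ofReal (√(2 * Real.pi * v))⁻¹ *
        (ENNReal.ofReal (√t - √r) + ENNReal.ofReal (√t - √r)) := by
        rw [Measure.smul_apply, smul_eq_mul]
        gcongr
        refine (measure_union_le _ _).trans_eq ?_
        rw [Real.volume_Icc, Real.volume_Icc]
        congr 2
        ring
    _ ≤ _ := by
        rw [← ENNReal.ofReal_add (by linarith) (by linarith), ← ENNReal.ofReal_mul (by positivity),
          ← ENNReal.ofReal_mul (by positivity)]
        refine ENNReal.ofReal_le_ofReal ?_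
        calc (√(2 * Real.pi * v))⁻¹ * (√t - √r + (√t - √r))
            ≤ (√(2 * Real.pi * v))⁻¹ * ((t - s) / (2 * √δ) + (t - s) / (2 * √δ)) := by gcongr
          _ = _ := by field_simp; ring

/-- The density of the square is unbounded only near 0. Above a threshold δ its boundedness controls
the convolution; below δ the mass is O(√(δ/v)), and there the concentration of β is used. -/
theorem Conc.sqGauss_conv {β : Measure ℝ} [IsProbabilityMeasure β] {M : ℝ} (hM : 0 < M)
    (h : Conc β (ENNReal.ofReal M)) {v : ℝ≥0} (hv : v ≠ 0) :
    Conc (sqGauss 0 v ∗ β) (ENNReal.ofReal (2 * √(M / v))) := by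
  have hv' : (0 : ℝ) < v := by positivity
  -- The threshold δ = 1/M makes both contributions of order √(M/v); together they are 3√M/√(2πv).
  have e : sqGauss 0 v = (sqGauss 0 v).restrict (Ici M⁻¹) + (sqGauss 0 v).restrict (Iio M⁻¹) := by
    rw [← compl_Ici, Measure.restrict_add_restrict_compl measurableSet_Ici]
  rw [e, Measure.add_conv, conv_comm (Measure.restrict _ (Iio _))]
  have h1 := (conc_sqGauss_restrict_Ici hv (inv_pos.2 hM)).conv β
  have h2 := h.conv_finite ((sqGauss 0 v).restrict (Iio M⁻¹))
  refine (h1.add h2).mono ?_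
  rw [Measure.restrict_apply_univ]
  calc _ ≤ _ := add_le_add le_rfl (mul_le_mul_right (sqGauss_Iio_le hv M⁻¹) _)
    _ ≤ _ := by
      rw [← ENNReal.ofReal_mul hM.le, ← ENNReal.ofReal_add (by positivity) (by positivity)]
      refine ENNReal.ofReal_le_ofReal ?_
      have hM' := Real.sqrt_pos.2 hM
      have hvs := Real.sqrt_pos.2 hv'
      have hpi : (9 / 4 : ℝ) ≤ 2 * Real.pi := by linarith [Real.pi_gt_three]
      have hpi' : 3 / 2 ≤ √(2 * Real.pi) := by
        rw [Real.le_sqrt (by norm_num) (by positivity)]; linarith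
      rw [Real.sqrt_div hM.le, Real.sqrt_inv, Real.sqrt_mul (by positivity)]
      have hMM : M = √M * √M := (Real.mul_self_sqrt hM.le).symm
      calc _ = 3 * √M / (√(2 * Real.pi) * √v) := by
            nth_rewrite 2 [hMM]
            field_simp
            ring
        _ ≤ 3 * √M / (3 / 2 * √v) := by gcongr
        _ = _ := by field_simp

theorem volume_annulus_le {s t : ℝ} (hst : s ≤ t) :
    (volume : Measure (ℝ × ℝ)) {p | p.1 ^ 2 + p.2 ^ 2 ∈ Ioc s t} ≤
      ENNReal.ofReal (Real.pi * (t - s)) := by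
  have hm : MeasurableSet {p : ℝ × ℝ | p.1 ^ 2 + p.2 ^ 2 ∈ Ioc s t} :=
    measurableSet_Ioc.preimage (f := fun p : ℝ × ℝ => p.1 ^ 2 + p.2 ^ 2) (by fun_prop)
  rw [← Complex.volume_preserving_equiv_real_prod.measure_preimage hm.nullMeasurableSet]
  have hc (r : ℝ) (hr : 0 ≤ r) : volume (Metric.closedBall (0 : ℂ) (√r)) =
      ENNReal.ofReal (Real.pi * r) := by
    rw [Complex.volume_closedBall, ← ENNReal.ofReal_pow (by positivity), Real.sq_sqrt hr,
      mul_comm, ENNReal.ofReal_mul (by positivity)]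
    congr 1
    rw [← ENNReal.ofReal_coe_nnreal]
    rfl
  have hn (z : ℂ) : (Complex.measurableEquivRealProd z).1 ^ 2 +
      (Complex.measurableEquivRealProd z).2 ^ 2 = ‖z‖ ^ 2 := by
    rw [← Complex.normSq_eq_norm_sq, Complex.normSq_apply]
    simp [Complex.measurableEquivRealProd_apply, sq]
  rcases lt_or_ge t 0 with ht | ht
  · refine (measure_mono_null (t := ∅) (fun z hz => ?_) measure_empty).le.trans zero_le
    have := hz.2
    rw [hn] at this
    exact absurd (sq_nonneg ‖z‖) (by linarith)
  have hsub (z : ℂ) (hz : ‖z‖ ^ 2 ≤ t) : z ∈ Metric.closedBall (0 : ℂ) (√t) := by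
    rw [mem_closedBall_zero_iff]
    exact Real.le_sqrt_of_sq_le hz
  rcases lt_or_ge s 0 with hs | hs
  · calc _ ≤ volume (Metric.closedBall (0 : ℂ) (√t)) := by
          refine measure_mono fun z hz => hsub z ?_
          have := hz.2
          rwa [hn] at this
      _ ≤ _ := by
          rw [hc t ht]
          refine ENNReal.ofReal_le_ofReal ?_
          nlinarith [Real.pi_pos]
  · calc _ ≤ volume (Metric.closedBall (0 : ℂ) (√t) \ Metric.closedBall (0 : ℂ) (√s)) := by
          refine measure_mono fun z hz => ?_
          have h1 := hz.1
          have h2 := hz.2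
          rw [hn] at h1 h2
          refine ⟨hsub z h2, fun h => ?_⟩
          rw [mem_closedBall_zero_iff] at h
          have := pow_le_pow_left₀ (norm_nonneg z) h 2
          rw [Real.sq_sqrt hs] at this
          linarith
      _ = _ := by
          rw [measure_sdiff (Metric.closedBall_subset_closedBall (Real.sqrt_le_sqrt hst))
            Metric.isClosed_closedBall.measurableSet.nullMeasurableSet (by rw [hc s hs]; simp),
            hc s hs, hc t ht, ← ENNReal.ofReal_sub _ (by positivity)]
          congr 1
          ring

/-- The planar density is at most 1/(2π√(vw)), and the annulus s < p₁² + p₂² ≤ t has area at most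
π(t - s). -/
theorem conc_sqGauss_conv_sqGauss {v w : ℝ≥0} (hv : v ≠ 0) (hw : w ≠ 0) :
    Conc (sqGauss 0 v ∗ sqGauss 0 w) (ENNReal.ofReal (1 / (2 * √(v * w)))) := by
  intro s t hst
  have hm : MeasurableSet {p : ℝ × ℝ | p.1 ^ 2 + p.2 ^ 2 ∈ Ioc s t} :=
    measurableSet_Ioc.preimage (f := fun p : ℝ × ℝ => p.1 ^ 2 + p.2 ^ 2) (by fun_prop)
  have e : (sqGauss 0 v ∗ sqGauss 0 w) (Ioc s t) =
      ((gaussianReal 0 v).prod (gaussianReal 0 w)) {p | p.1 ^ 2 + p.2 ^ 2 ∈ Ioc s t} := by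
    rw [Measure.conv, sqGauss, sqGauss, Measure.map_prod_map _ _ (by fun_prop) (by fun_prop),
      Measure.map_map (by fun_prop) (by fun_prop),
      Measure.map_apply (by fun_prop) measurableSet_Ioc]
    rfl
  rw [e]
  calc _ ≤ ((ENNReal.ofReal (√(2 * Real.pi * v))⁻¹ • (volume : Measure ℝ)).prod
        (ENNReal.ofReal (√(2 * Real.pi * w))⁻¹ • (volume : Measure ℝ)))
          {p | p.1 ^ 2 + p.2 ^ 2 ∈ Ioc s t} := by
        rw [Measure.prod_apply hm, Measure.prod_apply hm]
        exact lintegral_mono' (gaussianReal_le_smul_volume 0 hv) fun x =>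
          gaussianReal_le_smul_volume 0 hw _
    _ ≤ ENNReal.ofReal (√(2 * Real.pi * v))⁻¹ * (ENNReal.ofReal (√(2 * Real.pi * w))⁻¹ *
          ENNReal.ofReal (Real.pi * (t - s))) := by
        rw [Measure.prod_smul_left, Measure.prod_smul_right, Measure.smul_apply,
          Measure.smul_apply, smul_eq_mul, smul_eq_mul]
        gcongr
        exact volume_annulus_le hst
    _ = _ := by
        have hts : 0 ≤ t - s := by linarith
        rw [← ENNReal.ofReal_mul (by positivity), ← ENNReal.ofReal_mul (by positivity),
          ← ENNReal.ofReal_mul (by positivity)]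
        congr 1
        rw [Real.sqrt_mul (x := 2 * Real.pi) (by positivity) v,
          Real.sqrt_mul (x := 2 * Real.pi) (by positivity) w, Real.sqrt_mul v.coe_nonneg]
        have h2 := Real.mul_self_sqrt (show 0 ≤ 2 * Real.pi by positivity)
        have hv' : 0 < √(v : ℝ) := Real.sqrt_pos.2 (by positivity)
        have hw' : 0 < √(w : ℝ) := Real.sqrt_pos.2 (by positivity)
        have hp : 0 < √(2 * Real.pi) := Real.sqrt_pos.2 (by positivity)
        field_simp
        linear_combination -(t - s) * h2

/-! ### Concentration by Fourier analysis -/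

theorem integral_exp_neg_sq_eq_integral_charFun (μ : Measure ℝ) [IsProbabilityMeasure μ] (x : ℝ)
    (w : ℝ≥0) :
    ∫ y, Complex.exp (-(w * (y - x) ^ 2 / 2)) ∂μ =
      ∫ u, Complex.exp (-(u * x * Complex.I)) * charFun μ u ∂gaussianReal 0 w := by
  have h (y : ℝ) : Complex.exp (-(w * (y - x) ^ 2 / 2)) =
      ∫ u, Complex.exp (-(u * x * Complex.I)) * Complex.exp (u * y * Complex.I)
        ∂gaussianReal 0 w := by
    have := charFun_gaussianReal (μ := 0) (v := w) (y - x)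
    rw [charFun_apply_real] at this
    push_cast at this
    rw [show (-(w * (y - x) ^ 2 / 2) : ℂ) = (y - x) * 0 * Complex.I - w * (y - x) ^ 2 / 2 by ring,
      ← this]
    congr with u
    rw [← Complex.exp_add]
    congr 1
    ring
  simp_rw [h, charFun_apply_real, ← integral_const_mul]
  rw [integral_integral_swap]
  refine (integrable_const (1 : ℝ)).mono' (Measurable.aestronglyMeasurable (by fun_prop))
    (ae_of_all _ fun p => ?_)
  simp only [Function.uncurry]
  rw [norm_mul, ← Complex.ofReal_mul, ← Complex.ofReal_mul, ← neg_mul, ← Complex.ofReal_neg,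
    Complex.norm_exp_ofReal_mul_I, Complex.norm_exp_ofReal_mul_I, one_mul]

/-- Esseen's argument: a Gaussian bump at the midpoint dominates the indicator of the interval up to
a constant, and its integral against μ is an average of the characteristic function by Parseval. -/
theorem conc_lintegral_charFun (μ : Measure ℝ) [IsProbabilityMeasure μ] :
    Conc μ (∫⁻ u, ‖charFun μ u‖ₑ) := by
  intro s t hst
  rcases hst.eq_or_lt with rfl | hlt
  · simp
  set x := (s + t) / 2 with hx
  set h := (t - s) / 2 with hh
  have hpos : 0 < h := by simp only [hh]; linarith
  -- With w = h⁻², the bump is at least e^(-1/2) on the interval, and the density of N(0, w) is at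
  -- most h/√(2π), proportional to the length.
  set w : ℝ≥0 := ⟨(h ^ 2)⁻¹, by positivity⟩ with hw
  have hw' : (w : ℝ) = (h ^ 2)⁻¹ := rfl
  have hw0 : w ≠ 0 := by
    rw [← NNReal.coe_ne_zero, hw']; positivity
  have e1 : μ (Ioc s t) ≤ ENNReal.ofReal (Real.exp (1 / 2) *
      ∫ y, Real.exp (-(w * (y - x) ^ 2 / 2)) ∂μ) := by
    have hi : Integrable (fun y => Real.exp (-(w * (y - x) ^ 2 / 2))) μ := by
      refine (integrable_const (1 : ℝ)).mono' (by fun_prop) (ae_of_all _ fun y => ?_)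
      rw [Real.norm_eq_abs, Real.abs_exp, Real.exp_le_one_iff, neg_nonpos]
      positivity
    rw [← integral_const_mul, ofReal_integral_eq_lintegral_ofReal (hi.const_mul _)
      (ae_of_all _ fun y => by positivity), ← lintegral_indicator_one measurableSet_Ioc]
    refine lintegral_mono fun y => ?_
    by_cases hy : y ∈ Ioc s t
    · rw [indicator_of_mem hy, Pi.one_apply, ENNReal.one_le_ofReal, ← Real.exp_add]
      refine Real.one_le_exp ?_
      have : (y - x) ^ 2 ≤ h ^ 2 := by
        refine sq_le_sq' ?_ ?_ <;> simp only [hx, hh] <;> linarith [hy.1, hy.2]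
      have h2 : (h ^ 2)⁻¹ * (y - x) ^ 2 ≤ 1 := by
        rw [inv_mul_le_iff₀ (by positivity)]; simpa using this
      rw [hw']
      linarith
    · rw [indicator_of_notMem hy]
      positivity
  have e2 : ENNReal.ofReal (∫ y, Real.exp (-(w * (y - x) ^ 2 / 2)) ∂μ) ≤
      ∫⁻ u, ‖charFun μ u‖ₑ ∂gaussianReal 0 w := by
    calc ENNReal.ofReal (∫ y, Real.exp (-(w * (y - x) ^ 2 / 2)) ∂μ)
        ≤ ‖∫ y, Real.exp (-(w * (y - x) ^ 2 / 2)) ∂μ‖ₑ := Real.ofReal_le_enorm _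
      _ = ‖∫ y, Complex.exp (-(w * (y - x) ^ 2 / 2)) ∂μ‖ₑ := by
          have : (∫ y, Complex.exp (-(w * (y - x) ^ 2 / 2)) ∂μ) =
              ((∫ y, Real.exp (-(w * (y - x) ^ 2 / 2)) ∂μ : ℝ) : ℂ) := by
            rw [← integral_complex_ofReal]
            push_cast
            rfl
          rw [this, ← ofReal_norm, ← ofReal_norm, Complex.norm_real]
      _ = ‖∫ u, Complex.exp (-(u * x * Complex.I)) * charFun μ u ∂gaussianReal 0 w‖ₑ := by
          rw [integral_exp_neg_sq_eq_integral_charFun]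
      _ ≤ ∫⁻ u, ‖Complex.exp (-(u * x * Complex.I)) * charFun μ u‖ₑ ∂gaussianReal 0 w :=
          enorm_integral_le_lintegral_enorm _
      _ = _ := by
          refine lintegral_congr fun u => ?_
          rw [enorm_mul, ← Complex.ofReal_mul, ← neg_mul, ← Complex.ofReal_neg,
            ← ofReal_norm (Complex.exp _), Complex.norm_exp_ofReal_mul_I]
          simp
  have e3 : ∫⁻ u, ‖charFun μ u‖ₑ ∂gaussianReal 0 w ≤
      ENNReal.ofReal (h / √(2 * Real.pi)) * ∫⁻ u, ‖charFun μ u‖ₑ := by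
    calc _ ≤ _ := lintegral_mono' (gaussianReal_le_smul_volume 0 hw0) le_rfl
      _ = _ := by
        rw [lintegral_smul_measure, smul_eq_mul]
        congr 2
        rw [hw', Real.sqrt_mul (by positivity), Real.sqrt_inv, Real.sqrt_sq hpos.le]
        field_simp
  calc μ (Ioc s t) ≤ _ := e1
    _ = ENNReal.ofReal (Real.exp (1 / 2)) *
        ENNReal.ofReal (∫ y, Real.exp (-(w * (y - x) ^ 2 / 2)) ∂μ) :=
        ENNReal.ofReal_mul (Real.exp_pos _).le
    _ ≤ ENNReal.ofReal (Real.exp (1 / 2)) *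
        (ENNReal.ofReal (h / √(2 * Real.pi)) * ∫⁻ u, ‖charFun μ u‖ₑ) := by
        gcongr
        exact e2.trans e3
    _ = ENNReal.ofReal (Real.exp (1 / 2) * (h / √(2 * Real.pi))) * ∫⁻ u, ‖charFun μ u‖ₑ := by
        rw [ENNReal.ofReal_mul (Real.exp_pos _).le, mul_assoc]
    _ ≤ _ := by
        rw [mul_comm]
        gcongr
        have h1 : Real.exp (1 / 2) ≤ 2 := by
          have h3 : Real.exp (1 / 2) ^ 2 ≤ 2 ^ 2 := by
            rw [← Real.exp_nat_mul]
            norm_num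
            linarith [Real.exp_one_lt_d9]
          exact (pow_le_pow_iff_left₀ (by positivity) (by norm_num) two_ne_zero).1 h3
        have h2 : 1 ≤ √(2 * Real.pi) := by
          rw [Real.one_le_sqrt]; linarith [Real.pi_gt_three]
        calc Real.exp (1 / 2) * (h / √(2 * Real.pi)) ≤ 2 * (h / 1) := by gcongr
          _ = t - s := by simp only [hh]; ring

/-- Bernoulli's inequality for exponents in [0, 1]: each u_i/(θU) is at most 1, and these exponents
sum to 1/θ. It turns a bound on the largest term into polynomial decay of order 1/θ. -/
theorem one_add_rpow_le_prod {ι : Type*} (s : Finset ι) (u : ι → ℝ) (hu : ∀ i ∈ s, 0 ≤ u i)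
    {θ : ℝ} (hθ : 0 < θ) (h : ∀ i ∈ s, u i ≤ θ * ∑ j ∈ s, u j) :
    (1 + θ * ∑ j ∈ s, u j) ^ (1 / θ) ≤ ∏ i ∈ s, (1 + u i) := by
  set U := ∑ j ∈ s, u j with hU
  have hU0 : 0 ≤ U := Finset.sum_nonneg hu
  rcases hU0.eq_or_lt with h0 | h0
  · rw [← h0]
    simp only [mul_zero, add_zero, Real.one_rpow]
    exact Finset.one_le_prod fun i hi => by linarith [hu i hi]
  have e : 1 / θ = ∑ i ∈ s, u i / (θ * U) := by
    rw [← Finset.sum_div, ← hU]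
    field_simp
  rw [e, Real.rpow_sum_of_pos (by positivity)]
  refine Finset.prod_le_prod (fun i _ => by positivity) fun i hi => ?_
  have hs : -1 ≤ θ * U := by nlinarith
  calc (1 + θ * U) ^ (u i / (θ * U)) ≤ 1 + u i / (θ * U) * (θ * U) :=
        rpow_one_add_le_one_add_mul_self hs (by have := hu i hi; positivity)
          (div_le_one_of_le₀ (h i hi) (by positivity))
    _ = 1 + u i := by field_simp

/-- The integral of a power of `1 + x²` that bounds the characteristic functions below. -/
def decayConst : ℝ := ∫ x : ℝ, (1 + x ^ 2) ^ (-(5 / 8) : ℝ)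

theorem integrable_decay : Integrable fun x : ℝ => (1 + x ^ 2) ^ (-(5 / 8) : ℝ) := by
  have := integrable_rpow_neg_one_add_norm_sq (E := ℝ) (μ := volume) (r := 5 / 4) (by simp; norm_num)
  simp only [Real.norm_eq_abs, sq_abs] at this
  convert this using 3
  norm_num

theorem decayConst_nonneg : 0 ≤ decayConst := integral_nonneg fun x => by positivity

/-- Taking θ = 2/5 in `one_add_rpow_le_prod` turns the exponent -1/4 of each factor into -(5/2)(1/4)
= -5/8, which is below -1/2 and so makes the bound integrable. -/
theorem conc_sqLaw_of_balanced {ι : Type*} (s : Finset ι) (v : ι → ℝ≥0) {Λ : ℝ} (hΛ : 0 < Λ)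
    (hs : Λ ^ 2 ≤ ∑ i ∈ s, (v i : ℝ) ^ 2)
    (h : ∀ i ∈ s, (v i : ℝ) ^ 2 ≤ 2 / 5 * ∑ j ∈ s, (v j : ℝ) ^ 2) :
    Conc (sqLaw s (fun _ => 0) v) (ENNReal.ofReal (decayConst / Λ)) := by
  refine (conc_lintegral_charFun _).mono ?_
  have hb (t : ℝ) : ‖charFun (sqLaw s (fun _ => 0) v) t‖ₑ ≤
      ENNReal.ofReal ((1 + (Λ * t) ^ 2) ^ (-(5 / 8) : ℝ)) := by
    rw [charFun_sqLaw, ← ofReal_norm, norm_prod]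
    refine ENNReal.ofReal_le_ofReal ?_
    simp_rw [norm_charFun_sqGauss]
    rw [Real.finsetProd_rpow _ _ fun i _ => by positivity]
    have e : ∑ i ∈ s, 4 * t ^ 2 * (v i : ℝ) ^ 2 = 4 * t ^ 2 * ∑ i ∈ s, (v i : ℝ) ^ 2 := by
      rw [Finset.mul_sum]
    have h1 := one_add_rpow_le_prod s (fun i => 4 * t ^ 2 * (v i : ℝ) ^ 2)
      (fun i _ => by positivity) (θ := 2 / 5) (by norm_num) fun i hi => by
        rw [e]
        nlinarith [mul_le_mul_of_nonneg_left (h i hi) (show 0 ≤ 4 * t ^ 2 by positivity)]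
    rw [e] at h1
    calc (∏ i ∈ s, (1 + 4 * t ^ 2 * (v i : ℝ) ^ 2)) ^ (-(1 / 4) : ℝ)
        ≤ ((1 + 2 / 5 * (4 * t ^ 2 * ∑ i ∈ s, (v i : ℝ) ^ 2)) ^ (1 / (2 / 5) : ℝ)) ^
          (-(1 / 4) : ℝ) :=
          Real.rpow_le_rpow_of_nonpos (by positivity) h1 (by norm_num)
      _ = (1 + 2 / 5 * (4 * t ^ 2 * ∑ i ∈ s, (v i : ℝ) ^ 2)) ^ (-(5 / 8) : ℝ) := by
          rw [← Real.rpow_mul (by positivity)]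
          norm_num
      _ ≤ (1 + (Λ * t) ^ 2) ^ (-(5 / 8) : ℝ) := by
          refine Real.rpow_le_rpow_of_nonpos (by positivity) ?_ (by norm_num)
          nlinarith [mul_le_mul_of_nonneg_left hs (sq_nonneg t),
            mul_nonneg (sq_nonneg t) (sq_nonneg Λ)]
  calc ∫⁻ t, ‖charFun (sqLaw s (fun _ => 0) v) t‖ₑ
      ≤ ∫⁻ t, ENNReal.ofReal ((1 + (Λ * t) ^ 2) ^ (-(5 / 8) : ℝ)) := lintegral_mono hb
    _ = ENNReal.ofReal (∫ t, (1 + (Λ * t) ^ 2) ^ (-(5 / 8) : ℝ)) := by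
        rw [ofReal_integral_eq_lintegral_ofReal (integrable_decay.comp_mul_left' hΛ.ne')
          (ae_of_all _ fun t => by positivity)]
    _ = _ := by
        rw [Measure.integral_comp_mul_left (fun x : ℝ => (1 + x ^ 2) ^ (-(5 / 8) : ℝ)) Λ,
          abs_of_pos (by positivity), smul_eq_mul, ← decayConst]
        congr 1
        ring

/-! ### Concentration for a decreasing sequence of weights -/

theorem sqLaw_range_succ (n : ℕ) (m : ℕ → ℝ) (v : ℕ → ℝ≥0) :
    sqLaw (Finset.range (n + 1)) m v = sqGauss (m 0) (v 0) ∗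
      sqLaw (Finset.range n) (fun j => m (j + 1)) fun j => v (j + 1) := by
  refine ext_of_charFun (funext fun x => ?_)
  rw [charFun_conv, charFun_sqLaw, charFun_sqLaw, Finset.prod_range_succ', mul_comm]

/-- The constant of the concentration bound for weighted sums of squares. -/
def concConst : ℝ := 4 * (decayConst + 1)

theorem concConst_pos : 0 < concConst := by
  have := decayConst_nonneg
  unfold concConst
  positivity

theorem eventually_conc_sqLaw_of_balanced {l : ℕ → ℝ≥0} (hl : Antitone l) {s : ℝ}
    (hs : HasSum (fun j => (l j : ℝ) ^ 2) s) (hpos : 0 < s) (h0 : (l 0 : ℝ) ^ 2 ≤ s / 3) :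
    ∀ᶠ n in atTop, Conc (sqLaw (Finset.range n) (fun _ => 0) l)
      (ENNReal.ofReal (2 * (decayConst + 1) / √s)) := by
  have hD := decayConst_nonneg
  -- The fraction 5/6 is chosen so that 2/5 · 5/6 = 1/3: the bound s/3 on the largest square becomes
  -- the balance condition for the partial sum.
  filter_upwards [hs.tendsto_sum_nat.eventually (eventually_ge_nhds (show 5 / 6 * s < s by linarith))]
    with n hn
  have hss := Real.sqrt_pos.2 hpos
  refine (conc_sqLaw_of_balanced (Finset.range n) l (Λ := √s / 2) (by positivity) ?_ ?_).mono ?_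
  · rw [div_pow, Real.sq_sqrt hpos.le]
    linarith
  · intro i _
    have : (l i : ℝ) ^ 2 ≤ (l 0 : ℝ) ^ 2 := by gcongr; exact_mod_cast hl (Nat.zero_le i)
    linarith
  · refine ENNReal.ofReal_le_ofReal ?_
    rw [div_div_eq_mul_div]
    exact div_le_div_of_nonneg_right (by linarith) hss.le

theorem eventually_conc_sqLaw {l : ℕ → ℝ≥0} (hl : Antitone l) {s₁ s₂ : ℝ}
    (h₁ : HasSum (fun j => (l j : ℝ) ^ 2) s₁) (h₂ : HasSum (fun j => (l (j + 1) : ℝ) ^ 2) s₂)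
    (hpos : 0 < s₂) :
    ∀ᶠ n in atTop, Conc (sqLaw (Finset.range n) (fun _ => 0) l)
      (ENNReal.ofReal (concConst / √(√s₁ * √s₂))) := by
  have hD := decayConst_nonneg
  have hs : s₁ = s₂ + l 0 ^ 2 := by
    have := (hasSum_nat_add_iff (f := fun j => (l j : ℝ) ^ 2) 1).1 h₂
    simpa using h₁.unique this
  have hle : s₂ ≤ s₁ := by rw [hs]; linarith [sq_nonneg (l 0 : ℝ)]
  have hpos₁ : 0 < s₁ := hpos.trans_le hle
  have r₁ := Real.sqrt_pos.2 hpos₁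
  have r₂ := Real.sqrt_pos.2 hpos
  have hq := Real.sqrt_pos.2 (mul_pos r₁ r₂)
  -- Here s₁ = Λ₁² and s₂ = Λ₂². A square above a third of its tail sum makes that weight at least
  -- half of the corresponding Λ.
  have key {x s : ℝ} (hx : 0 ≤ x) (h : s / 3 < x ^ 2) : √s / 2 ≤ x := by
    rw [div_le_iff₀ two_pos]
    refine Real.sqrt_le_left (by positivity) |>.2 ?_
    nlinarith
  rcases le_or_gt ((l 0 : ℝ) ^ 2) (s₁ / 3) with h0 | h0
  · filter_upwards [eventually_conc_sqLaw_of_balanced hl h₁ hpos₁ h0] with n hn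
    refine hn.mono (ENNReal.ofReal_le_ofReal ?_)
    unfold concConst
    gcongr
    · norm_num
    · calc √s₁ * √s₂ ≤ √s₁ * √s₁ := by gcongr
        _ = s₁ := Real.mul_self_sqrt hpos₁.le
  have hl0 : √s₁ / 2 ≤ l 0 := key (l 0).coe_nonneg h0
  have hl0' : l 0 ≠ 0 := by
    rw [← NNReal.coe_ne_zero]; exact ((by positivity : 0 < √s₁ / 2).trans_le hl0).ne'
  rcases le_or_gt ((l 1 : ℝ) ^ 2) (s₂ / 3) with h1 | h1
  · have hl' : Antitone fun j => l (j + 1) := fun i j hij => hl (by lia)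
    have := eventually_conc_sqLaw_of_balanced hl' h₂ hpos (by simpa using h1)
    obtain ⟨N, hN⟩ := eventually_atTop.1 this
    refine eventually_atTop.2 ⟨N + 1, fun n hn => ?_⟩
    obtain ⟨k, rfl⟩ : ∃ k, n = k + 1 := ⟨n - 1, by lia⟩
    rw [sqLaw_range_succ]
    refine (Conc.sqGauss_conv (by positivity) (hN k (by lia)) hl0').mono
      (ENNReal.ofReal_le_ofReal ?_)
    have hD1 : √(decayConst + 1) ≤ decayConst + 1 :=
      Real.sqrt_le_left (by positivity) |>.2 (by nlinarith)
    calc 2 * √(2 * (decayConst + 1) / √s₂ / l 0)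
        ≤ 2 * √(2 * (decayConst + 1) / √s₂ / (√s₁ / 2)) := by gcongr
      _ = 2 * √(2 ^ 2 * (decayConst + 1) / (√s₁ * √s₂)) := by
          congr 2
          field_simp
      _ = 4 * √(decayConst + 1) / √(√s₁ * √s₂) := by
          rw [Real.sqrt_div (by positivity), Real.sqrt_mul (by positivity),
            Real.sqrt_sq (by norm_num)]
          ring
      _ ≤ 4 * (decayConst + 1) / √(√s₁ * √s₂) := by gcongr
  · have hl1 : √s₂ / 2 ≤ l 1 := key (l 1).coe_nonneg h1
    have hl1' : l 1 ≠ 0 := by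
      rw [← NNReal.coe_ne_zero]; exact ((by positivity : 0 < √s₂ / 2).trans_le hl1).ne'
    filter_upwards [eventually_ge_atTop 2] with n hn
    obtain ⟨k, rfl⟩ := Nat.exists_eq_add_of_le hn
    rw [add_comm 2 k, sqLaw_range_succ, sqLaw_range_succ, ← conv_assoc]
    refine ((conc_sqGauss_conv_sqGauss hl0' hl1').conv _).mono (ENNReal.ofReal_le_ofReal ?_)
    have : √(√s₁ * √s₂) / 2 ≤ √(l 0 * l 1) := by
      refine Real.le_sqrt_of_sq_le ?_
      rw [div_pow, Real.sq_sqrt (by positivity)]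
      calc √s₁ * √s₂ / 2 ^ 2 = √s₁ / 2 * (√s₂ / 2) := by ring
        _ ≤ _ := by gcongr
    calc 1 / (2 * √(l 0 * l 1 : ℝ)) ≤ 1 / (2 * (√(√s₁ * √s₂) / 2)) := by gcongr
      _ = 1 / √(√s₁ * √s₂) := by congr 1; ring
      _ ≤ _ := by
        unfold concConst
        gcongr
        linarith

/-! ### Comparison of finite sums of squares -/

theorem Dom.sqLaw_shift {ι : Type*} (s : Finset ι) (m : ι → ℝ) (v : ι → ℝ≥0) :
    Dom (GaussianComparison.sqLaw s (fun _ => 0) v) (GaussianComparison.sqLaw s m v)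
      (∑ i ∈ s, ENNReal.ofReal (m i ^ 2)) :=
  Dom.sqLaw fun i _ => Dom.sqGauss_shift (m i) (v i)

theorem Dom.sqLaw_scale {ι : Type*} (s : Finset ι) {v w : ι → ℝ≥0} (h : v ≤ w) :
    Dom (GaussianComparison.sqLaw s (fun _ => 0) v) (GaussianComparison.sqLaw s (fun _ => 0) w)
      (∑ i ∈ s, ((w i - v i : ℝ≥0) : ℝ≥0∞)) := by
  refine Dom.sqLaw fun i _ => ?_
  have := Dom.sqGauss_scale (v i) (w i - v i)
  rwa [add_tsub_cancel_of_le (h i)] at this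

theorem conc_top (μ : Measure ℝ) : Conc μ ⊤ := by
  intro s t hst
  rcases hst.eq_or_lt with rfl | h
  · simp
  · rw [ENNReal.top_mul (by simpa using h)]
    exact le_top

/-- Comparison of two centred weighted sums of squares whose laws have bounded concentration. -/
theorem sqLaw_Iic_le {ι : Type*} (s : Finset ι) (v w : ι → ℝ≥0) {M : ℝ≥0∞}
    (hM : Conc (sqLaw s (fun _ => 0) v) M) {x : ℝ} :
    sqLaw s (fun _ => 0) v (Iic x) ≤ sqLaw s (fun _ => 0) w (Iic x) +
      M * ∑ i ∈ s, ((w i - v i : ℝ≥0) : ℝ≥0∞) := by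
  -- Pass from v up to v ⊔ w at cost M times the sum of (w - v)⁺, then down to w by monotonicity
  -- alone. The second step needs no concentration, so the bound `⊤` is enough.
  have hu : v ≤ v ⊔ w := le_sup_left
  have e : ∀ i, (v ⊔ w) i - v i = w i - v i := fun i => by
    rw [Pi.sup_apply]
    rcases le_total (v i) (w i) with h | h
    · rw [sup_eq_right.2 h]
    · rw [sup_eq_left.2 h, tsub_self, tsub_eq_zero_of_le h]
  have h1 := (((Dom.sqLaw_scale s hu).apply hM).2 x).2
  have h2 := (((Dom.sqLaw_scale s (le_sup_right : w ≤ v ⊔ w)).apply (conc_top _)).2 x).1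
  simp only [e] at h1
  exact h1.trans (by gcongr)

universe u

/-! ### Spectral theory of the covariance operator -/

section Operator

variable {H : Type*} [NormedAddCommGroup H] [InnerProductSpace ℝ H]

theorem countable_of_orthonormal [SecondCountableTopology H] {ι : Type*} {b : ι → H}
    (hb : Orthonormal ℝ b) : Countable ι := by
  have hd : Pairwise (Function.onFun Disjoint fun i => Metric.ball (b i) (1 / 2)) := by
    intro i j hij
    refine Metric.ball_disjoint_ball ?_
    rw [dist_eq_norm, add_halves]
    have h1 : ‖b i - b j‖ ^ 2 = 2 := by
      rw [norm_sub_sq_real, hb.1 i, hb.1 j, hb.2 hij]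
      norm_num
    nlinarith [norm_nonneg (b i - b j)]
  exact hd.countable_of_isOpen_disjoint (fun i => Metric.isOpen_ball)
    fun i => Metric.nonempty_ball.2 (by norm_num)

theorem isCompactOperator_starProjection_comp (U : Submodule ℝ H) [FiniteDimensional ℝ U]
    (T : H →L[ℝ] H) : IsCompactOperator (U.starProjection ∘L T) := by
  have h1 : IsCompactOperator (id : U → U) := (isCompactOperator_id_iff_finiteDimensional (𝕜 := ℝ)).2
    (inferInstance : FiniteDimensional ℝ U)
  exact (h1.comp_clm (U.orthogonalProjectionOnto ∘L T)).clm_comp U.subtypeL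

theorem orthogonal_eq_of_hilbertBasis {ι : Type*} {K : Submodule ℝ H} (b : HilbertBasis ι ℝ K)
    {x : H} (h : ∀ i, inner ℝ (b i : H) x = 0) : x ∈ Kᗮ := by
  rw [Submodule.mem_orthogonal]
  intro y hy
  have h1 := (b.hasSum_repr ⟨y, hy⟩).mapL K.subtypeL
  have h2 := h1.mapL ((innerSL ℝ).flip x)
  simp only [map_smul, Submodule.subtypeL_apply, ContinuousLinearMap.flip_apply,
    innerSL_apply_apply, h, smul_zero] at h2
  exact h2.unique hasSum_zero

variable [CompleteSpace H] [SecondCountableTopology H] [MeasurableSpace H] [BorelSpace H]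

/-- Composing with projections onto the spans of initial segments of a dense sequence gives
finite-rank approximations; the error in operator norm is at most ∫ ‖y‖‖y - U_n y‖ dμ, which tends
to 0 by dominated convergence. -/
theorem isCompactOperator_covarianceOperator {μ : Measure H} [IsFiniteMeasure μ]
    (hμ : MemLp id 2 μ) : IsCompactOperator (covarianceOperator μ) := by
  let U (n : ℕ) : Submodule ℝ H := Submodule.span ℝ (TopologicalSpace.denseSeq H '' Iio n)
  have hfin (n : ℕ) : FiniteDimensional ℝ (U n) :=
    FiniteDimensional.span_of_finite ℝ ((finite_Iio n).image _)
  have hmono : Monotone U := fun m n hmn =>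
    Submodule.span_mono (image_mono (Iio_subset_Iio hmn))
  have hdense : ⊤ ≤ (⨆ n, U n).topologicalClosure := by
    intro x _
    have hx := TopologicalSpace.denseRange_denseSeq H x
    refine closure_mono ?_ hx
    rintro _ ⟨n, rfl⟩
    exact Submodule.mem_iSup_of_mem (n + 1) (Submodule.subset_span ⟨n, by simp, rfl⟩)
  have hlim (x : H) := Submodule.starProjection_tendsto_self U hmono x hdense
  have hb (n : ℕ) (y : H) : ‖y - (U n).starProjection y‖ ≤ ‖y‖ := by
    have := (U n)ᗮ.norm_starProjection_apply_le y
    rwa [Submodule.starProjection_orthogonal_val] at this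
  have hi2 : Integrable (fun y : H => ‖y‖ ^ 2) μ := hμ.integrable_norm_pow two_ne_zero
  have hint (n : ℕ) : Integrable (fun y : H => ‖y‖ * ‖y - (U n).starProjection y‖) μ := by
    refine hi2.mono' (by fun_prop) (ae_of_all _ fun y => ?_)
    rw [Real.norm_of_nonneg (by positivity), sq]
    gcongr
    exact hb n y
  have hnorm (n : ℕ) : ‖(U n).starProjection ∘L covarianceOperator μ - covarianceOperator μ‖ ≤
      ∫ y, ‖y‖ * ‖y - (U n).starProjection y‖ ∂μ := by
    refine ContinuousLinearMap.opNorm_le_bound _ (integral_nonneg fun y => by positivity)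
      fun x => ?_
    have hix : Integrable (fun y => inner ℝ x y • y) μ :=
      memLp_one_iff_integrable.1 <| hμ.smul (hμ.const_inner x)
    have e : ((U n).starProjection ∘L covarianceOperator μ - covarianceOperator μ) x =
        -∫ y, inner ℝ x y • (y - (U n).starProjection y) ∂μ := by
      simp only [_root_.sub_apply, ContinuousLinearMap.comp_apply,
        covarianceOperator_apply hμ]
      rw [← ContinuousLinearMap.integral_comp_comm _ hix, ← integral_sub _ hix, ← integral_neg]
      · congr with y
        simp [smul_sub]
      · exact ContinuousLinearMap.integrable_comp _ hix
    rw [e, norm_neg, ← integral_mul_const]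
    refine norm_integral_le_of_norm_le ((hint n).mul_const _) (ae_of_all _ fun y => ?_)
    rw [norm_smul]
    calc ‖inner ℝ x y‖ * ‖y - (U n).starProjection y‖
        ≤ ‖x‖ * ‖y‖ * ‖y - (U n).starProjection y‖ := by
          gcongr
          exact norm_inner_le_norm x y
      _ = _ := by ring
  have hzero : Tendsto (fun n => ∫ y, ‖y‖ * ‖y - (U n).starProjection y‖ ∂μ) atTop (𝓝 0) := by
    rw [← integral_zero H ℝ (μ := μ)]
    refine tendsto_integral_of_dominated_convergence (fun y => ‖y‖ ^ 2)
      (fun n => (hint n).aestronglyMeasurable) hi2 (fun n => ae_of_all _ fun y => ?_)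
      (ae_of_all _ fun y => ?_)
    · rw [Real.norm_of_nonneg (by positivity), sq]
      gcongr
      exact hb n y
    · have := ((hlim y).const_sub y).norm.const_mul ‖y‖
      simpa using this
  refine isCompactOperator_of_tendsto (l := atTop)
    (F := fun n => (U n).starProjection ∘L covarianceOperator μ) ?_
    (Eventually.of_forall fun n => isCompactOperator_starProjection_comp _ _)
  rw [tendsto_iff_norm_sub_tendsto_zero]
  exact squeeze_zero (fun n => norm_nonneg _) hnorm hzero

theorem exists_hilbertBasis_eigenvectors {H : Type u} [NormedAddCommGroup H]
    [InnerProductSpace ℝ H] [CompleteSpace H] {T : H →L[ℝ] H} (hT : IsCompactOperator T)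
    (hp : (T : H →ₗ[ℝ] H).IsPositive) :
    ∃ (ι : Type u) (b : HilbertBasis ι ℝ H) (v : ι → ℝ≥0), ∀ i, T (b i) = (v i : ℝ) • b i := by
  have hs := hp.isSymmetric
  have hbasis (μ : ℝ) : ∃ (w : Set (Module.End.eigenspace (T : H →ₗ[ℝ] H) μ))
      (b : HilbertBasis w ℝ (Module.End.eigenspace (T : H →ₗ[ℝ] H) μ)), ⇑b = ((↑) : w → _) := by
    have : CompleteSpace (Module.End.eigenspace (T : H →ₗ[ℝ] H) μ) := by
      refine IsClosed.completeSpace_coe (hs := ?_)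
      have : (Module.End.eigenspace (T : H →ₗ[ℝ] H) μ : Set H) = {x | T x = μ • x} := by
        ext x
        simp
      rw [this]
      exact isClosed_eq (by fun_prop) (by fun_prop)
    exact exists_hilbertBasis ℝ _
  choose w b hb using hbasis
  let f : (Σ μ : ℝ, w μ) → H := fun p => (b p.1 p.2 : H)
  have hf : Orthonormal ℝ f :=
    hs.orthogonalFamily_eigenspaces.orthonormal_sigma_orthonormal fun μ => (b μ).orthonormal
  have hTf (p : Σ μ : ℝ, w μ) : T (f p) = p.1 • f p :=
    Module.End.mem_eigenspace_iff.1 (b p.1 p.2).2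
  have hspan : (Submodule.span ℝ (range f))ᗮ = ⊥ := by
    rw [eq_bot_iff, ← ContinuousLinearMap.orthogonalComplement_iSup_eigenspaces_eq_bot hT hs]
    intro x hx
    rw [← Submodule.iInf_orthogonal, Submodule.mem_iInf]
    exact fun μ => orthogonal_eq_of_hilbertBasis (b μ) fun i =>
      Submodule.mem_orthogonal _ _ |>.1 hx _ (Submodule.subset_span ⟨⟨μ, i⟩, rfl⟩)
  refine ⟨_, HilbertBasis.mkOfOrthogonalEqBot hf hspan, fun p => ⟨p.1, ?_⟩, fun p => ?_⟩
  · have h := hp.2 (f p)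
    rw [ContinuousLinearMap.coe_coe, hTf p, inner_smul_left, real_inner_self_eq_norm_sq,
      hf.1 p] at h
    simpa using h
  · rw [HilbertBasis.coe_mkOfOrthogonalEqBot]
    exact hTf p

end Operator

/-! ### Ordered eigenvalues as a rearrangement of the diagonal entries -/

section Eigenvalue

variable {H : Type*} [NormedAddCommGroup H] [InnerProductSpace ℝ H] {ι : Type*}

theorem iSup_eigenspace_eq_span {T : H →L[ℝ] H} (b : HilbertBasis ι ℝ H) {v : ι → ℝ≥0}
    (hT : ∀ i, T (b i) = (v i : ℝ) • b i) (hs : (T : H →ₗ[ℝ] H).IsSymmetric)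
    (hfin : ∀ c : ℝ, 0 < c → {i | c ≤ v i}.Finite) {c : ℝ} (hc : 0 < c) :
    (⨆ μ ∈ Ici c, Module.End.eigenspace (T : Module.End ℝ H) μ) =
      Submodule.span ℝ (b '' {i | c ≤ v i}) := by
  apply le_antisymm
  · refine iSup₂_le fun μ hμ x hx => ?_
    have hx' : T x = μ • x := Module.End.mem_eigenspace_iff.1 hx
    have h0 (i : ι) (hi : i ∉ (hfin c hc).toFinset) : b.repr x i • b i = 0 := by
      have h1 : (v i : ℝ) * inner ℝ (b i) x = μ * inner ℝ (b i) x := by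
        rw [← real_inner_smul_left, ← hT, ← real_inner_smul_right, ← hx']
        exact hs (b i) x
      rw [b.repr_apply_apply]
      have hne : (v i : ℝ) ≠ μ := by
        rintro rfl
        exact hi (by simpa using hμ)
      rw [(mul_eq_mul_right_iff.1 h1).resolve_left hne, zero_smul]
    have hx2 := (b.hasSum_repr x).unique (hasSum_sum_of_ne_finset_zero h0)
    rw [hx2]
    refine Submodule.sum_mem _ fun i hi => Submodule.smul_mem _ _ (Submodule.subset_span ⟨i, ?_, rfl⟩)
    simpa using hi
  · rw [Submodule.span_le]
    rintro _ ⟨i, hi, rfl⟩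
    exact Submodule.mem_iSup_of_mem (v i : ℝ) (Submodule.mem_iSup_of_mem hi
      (Module.End.mem_eigenspace_iff.2 (hT i)))

theorem rank_iSup_eigenspace {T : H →L[ℝ] H} (b : HilbertBasis ι ℝ H) {v : ι → ℝ≥0}
    (hT : ∀ i, T (b i) = (v i : ℝ) • b i) (hs : (T : H →ₗ[ℝ] H).IsSymmetric)
    (hfin : ∀ c : ℝ, 0 < c → {i | c ≤ v i}.Finite) {c : ℝ} (hc : 0 < c) :
    Module.rank ℝ ↥(⨆ μ ∈ Ici c, Module.End.eigenspace (T : Module.End ℝ H) μ) =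
      ({i | c ≤ v i}.ncard : Cardinal) := by
  have hli := b.orthonormal.linearIndependent
  rw [iSup_eigenspace_eq_span b hT hs hfin hc, rank_span_set (hli.linearIndepOn_id.mono
    (image_subset_range _ _)), ← ncard_image_of_injective _ hli.injective]
  have := ((hfin c hc).image b).to_subtype
  rw [← Nat.card_coe_set_eq, Nat.cast_card]

/-- The supremum defining `eigenvalue` is over the levels c for which at least k diagonal entries
are ≥ c. It is attained because this count is left-continuous on c > 0. -/
theorem le_eigenvalue_iff {T : H →L[ℝ] H} (b : HilbertBasis ι ℝ H) {v : ι → ℝ≥0}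
    (hT : ∀ i, T (b i) = (v i : ℝ) • b i) (hs : (T : H →ₗ[ℝ] H).IsSymmetric)
    (hfin : ∀ c : ℝ, 0 < c → {i | c ≤ v i}.Finite) {c : ℝ} (hc : 0 < c) {k : ℕ} (hk : k ≠ 0) :
    c ≤ eigenvalue T k ↔ k ≤ {i | c ≤ v i}.ncard := by
  have e : eigenvalue T k = sSup {c : ℝ | 0 < c ∧ k ≤ {i | c ≤ (v i : ℝ)}.ncard} := by
    unfold eigenvalue
    congr 1
    ext c
    refine and_congr_right fun hc => ?_
    rw [rank_iSup_eigenspace b hT hs hfin hc, Nat.cast_le]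
  have hne {c : ℝ} (hc : k ≤ {i | c ≤ (v i : ℝ)}.ncard) : {i | c ≤ (v i : ℝ)}.Nonempty := by
    rw [nonempty_iff_ne_empty]
    rintro h
    rw [h, ncard_empty] at hc
    lia
  rw [e]
  constructor
  · intro h
    by_contra! hlt
    -- Only finitely many entries exceed c/2, so none lies in [c', c) for some c' slightly below c.
    obtain ⟨c', hc'0, hc', heq⟩ : ∃ c' : ℝ, 0 < c' ∧ c' < c ∧ ∀ i, c' ≤ v i → c ≤ v i := by
      have hF := (hfin (c / 2) (by linarith))
      have h1 : ∀ᶠ c' : ℝ in 𝓝[<] c, ∀ i ∈ {i | c / 2 ≤ (v i : ℝ)}, c' ≤ v i → c ≤ v i := by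
        rw [Filter.eventually_all_finite hF]
        intro i _
        by_cases hi : c ≤ v i
        · exact Eventually.of_forall fun _ _ => hi
        · filter_upwards [Ioo_mem_nhdsLT (not_le.1 hi)] with c' hc' h
          exact absurd hc'.1 (not_lt.2 h)
      obtain ⟨c', h2, h3⟩ := (h1.and (Ioo_mem_nhdsLT (show c / 2 < c by linarith))).exists
      exact ⟨c', by linarith [h3.1], h3.2, fun i hi => h2 i (by simp only [mem_ofPred_eq]; linarith [h3.1]) hi⟩
    refine absurd h (not_le.2 (lt_of_le_of_lt (Real.sSup_le ?_ hc'0.le) hc'))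
    rintro d ⟨hd0, hd⟩
    by_contra! hcd
    refine absurd (hd.trans (ncard_le_ncard (fun i hi => heq i ?_) (hfin c hc))) (not_le.2 hlt)
    exact hcd.le.trans hi
  · intro h
    refine le_csSup ?_ ⟨hc, h⟩
    refine ⟨‖T‖, ?_⟩
    rintro d ⟨hd0, hd⟩
    obtain ⟨i, hi⟩ := hne hd
    have := T.le_opNorm (b i)
    rw [hT, norm_smul, b.orthonormal.1 i, mul_one, mul_one, NNReal.norm_eq] at this
    exact le_trans hi this

theorem ncard_fiber_eq_sub {f : ι → ℝ} (hf : ∀ c, 0 < c → {i | c ≤ f i}.Finite) {c c' : ℝ}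
    (hc : 0 < c) (hcc' : c < c') (h : ∀ i, c < f i → c' ≤ f i) :
    {i | f i = c}.ncard = {i | c ≤ f i}.ncard - {i | c' ≤ f i}.ncard := by
  have hsub : {i | c' ≤ f i} ⊆ {i | c ≤ f i} := fun i hi => hcc'.le.trans hi
  rw [← ncard_sdiff hsub (hf c' (hc.trans hcc'))]
  congr 1
  ext i
  refine ⟨fun hi => ⟨ge_of_eq hi, fun h' => ?_⟩, fun ⟨h1, h2⟩ => ?_⟩
  · have h1 : f i = c := hi
    have h2 : c' ≤ f i := h'
    linarith
  · exact le_antisymm (not_lt.1 fun h3 => h2 (h i h3)) h1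

theorem eventually_lt_imp_le {f : ι → ℝ} {c : ℝ} (hf : {i | c ≤ f i}.Finite) :
    ∀ᶠ c' in 𝓝[>] c, ∀ i, c < f i → c' ≤ f i := by
  have h1 : ∀ᶠ c' in 𝓝[>] c, ∀ i ∈ {i | c ≤ f i}, c < f i → c' ≤ f i := by
    rw [Filter.eventually_all_finite hf]
    intro i _
    by_cases hi : c < f i
    · filter_upwards [Ioo_mem_nhdsGT hi] with c' hc' _ using hc'.2.le
    · exact Eventually.of_forall fun _ h => absurd h hi
  filter_upwards [h1] with c' h i hi using h i (le_of_lt hi) hi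

/-- Equal counts above every positive level force fibres of equal finite size over every positive
value; gluing bijections of the fibres matches the positive parts. Zeros are left out, as their
multiplicities may differ. -/
theorem exists_injective_of_ncard_eq {κ : Type*} {f : ι → ℝ} {g : κ → ℝ}
    (hf : ∀ c, 0 < c → {i | c ≤ f i}.Finite) (hg : ∀ c, 0 < c → {j | c ≤ g j}.Finite)
    (h : ∀ c, 0 < c → {i | c ≤ f i}.ncard = {j | c ≤ g j}.ncard) :
    ∃ e : {j // 0 < g j} → ι, Function.Injective e ∧ (∀ j, f (e j) = g j) ∧
      ∀ i, 0 < f i → ∃ j, e j = i := by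
  have hfib (c : ℝ) (hc : 0 < c) : Nonempty ({j // g j = c} ≃ {i // f i = c}) := by
    have : Finite {j // g j = c} := ((hg c hc).subset fun j hj => ge_of_eq hj).to_subtype
    have : Finite {i // f i = c} := ((hf c hc).subset fun j hj => ge_of_eq hj).to_subtype
    obtain ⟨c', ⟨h1, h2⟩, hcc'⟩ := (((eventually_lt_imp_le (hf c hc)).and
      (eventually_lt_imp_le (hg c hc))).and self_mem_nhdsWithin).exists
    have := ncard_fiber_eq_sub hg hc hcc' h2
    rw [← h c hc, ← h c' (hc.trans hcc'), ← ncard_fiber_eq_sub hf hc hcc' h1] at this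
    exact Finite.card_eq.1 this
  let φ (c : ℝ) (hc : 0 < c) := (hfib c hc).some
  have hφ (c : ℝ) (j : {j // 0 < g j}) (hj : g j = c) (hc : 0 < c) :
      (φ (g j) j.2 ⟨j, rfl⟩ : ι) = φ c hc ⟨j, hj⟩ := by
    subst hj
    rfl
  have hg' (j : {j // 0 < g j}) : f (φ (g j) j.2 ⟨j, rfl⟩) = g j := (φ (g j) j.2 ⟨j, rfl⟩).2
  refine ⟨fun j => φ (g j) j.2 ⟨j, rfl⟩, fun j j' hjj' => ?_, hg', fun i hi => ?_⟩
  · have e : g j = g j' := by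
      rw [← hg' j, ← hg' j']
      exact congrArg f hjj'
    simp only [hφ (g j') j e j'.2] at hjj'
    have := (φ (g j') j'.2).injective (Subtype.ext hjj')
    exact Subtype.ext (Subtype.mk.inj this)
  · obtain ⟨⟨j, hj⟩, hji⟩ := (φ (f i) hi).surjective ⟨i, rfl⟩
    refine ⟨⟨j, hj.symm ▸ hi⟩, ?_⟩
    simp only [hφ (f i) ⟨j, hj.symm ▸ hi⟩ hj hi, hji]

theorem eigenvalue_nonneg (T : H →L[ℝ] H) (k : ℕ) : 0 ≤ eigenvalue T k :=
  Real.sSup_nonneg fun _ hc => hc.1.le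

/-- The ordered eigenvalues `λ_1 ≥ λ_2 ≥ …` as a sequence indexed from `0`. -/
def eigenSeq (T : H →L[ℝ] H) (j : ℕ) : ℝ≥0 := ⟨eigenvalue T (1 + j), eigenvalue_nonneg T _⟩

theorem coe_eigenSeq (T : H →L[ℝ] H) (j : ℕ) : (eigenSeq T j : ℝ) = eigenvalue T (1 + j) := rfl

/-- `T` is diagonal in the Hilbert basis `b` with summable eigenvalues `v`. -/
structure IsDiagonal (T : H →L[ℝ] H) (b : HilbertBasis ι ℝ H) (v : ι → ℝ≥0) : Prop where
  apply_basis : ∀ i, T (b i) = (v i : ℝ) • b i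
  isSymmetric : (T : H →ₗ[ℝ] H).IsSymmetric
  summable : Summable v

namespace IsDiagonal

variable {T : H →L[ℝ] H} {b : HilbertBasis ι ℝ H} {v : ι → ℝ≥0}

theorem finite_le (h : IsDiagonal T b v) {c : ℝ} (hc : 0 < c) : {i | c ≤ v i}.Finite := by
  have h1 : Tendsto (fun i => (v i : ℝ)) cofinite (𝓝 0) :=
    (NNReal.summable_coe.2 h.summable).tendsto_cofinite_zero
  have h2 : ∀ᶠ i in cofinite, (v i : ℝ) < c := h1.eventually (gt_mem_nhds hc)
  simpa [Filter.eventually_cofinite] using h2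

theorem le_eigenSeq_iff (h : IsDiagonal T b v) {c : ℝ} (hc : 0 < c) {j : ℕ} :
    c ≤ eigenSeq T j ↔ j < {i | c ≤ v i}.ncard := by
  rw [coe_eigenSeq, le_eigenvalue_iff b h.apply_basis h.isSymmetric (fun c hc => h.finite_le hc) hc
    (by lia)]
  lia

theorem antitone_eigenSeq (h : IsDiagonal T b v) : Antitone (eigenSeq T) := by
  intro i j hij
  rcases eq_zero_or_pos (eigenSeq T j) with h0 | h0
  · exact h0.le.trans zero_le
  · have h1 := (h.le_eigenSeq_iff (j := j) (NNReal.coe_pos.2 h0)).1 le_rfl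
    exact NNReal.coe_le_coe.1 ((h.le_eigenSeq_iff (NNReal.coe_pos.2 h0)).2 (hij.trans_lt h1))

theorem exists_rearrangement (h : IsDiagonal T b v) :
    ∃ e : {j // 0 < eigenSeq T j} → ι, Function.Injective e ∧ (∀ j, v (e j) = eigenSeq T j) ∧
      ∀ i, 0 < v i → ∃ j, e j = i := by
  have hset (c : ℝ) (hc : 0 < c) :
      {j | c ≤ (eigenSeq T j : ℝ)} = Iio ({i | c ≤ (v i : ℝ)}.ncard) := by
    ext j
    exact h.le_eigenSeq_iff hc
  obtain ⟨e, he, hv, hs⟩ := exists_injective_of_ncard_eq (f := fun i => (v i : ℝ))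
    (g := fun j => (eigenSeq T j : ℝ)) (fun c hc => h.finite_le hc)
    (fun c hc => by rw [hset c hc]; exact finite_Iio _)
    (fun c hc => by rw [hset c hc, ← Finset.coe_Iio, ncard_coe_finset, Nat.card_Iio])
  exact ⟨e, he, fun j => NNReal.coe_injective (hv j), hs⟩

theorem tsum_eigenSeq (h : IsDiagonal T b v) {F : ℝ≥0 → ℝ≥0∞} (hF : F 0 = 0) :
    ∑' j, F (eigenSeq T j) = ∑' i, F (v i) := by
  obtain ⟨e, he, hv, hs⟩ := h.exists_rearrangement
  have e1 : ∑' j, F (eigenSeq T j) = ∑' j : {j // 0 < eigenSeq T j}, F (eigenSeq T j) := by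
    refine (tsum_subtype_eq_of_support_subset (s := {j | 0 < eigenSeq T j})
      (f := fun j => F (eigenSeq T j)) fun j hj => ?_).symm
    refine (pos_iff_ne_zero (a := eigenSeq T j)).2 fun h0 => hj ?_
    simp only [h0, hF]
  rw [e1, ← he.tsum_eq (f := fun i => F (v i)) fun i hi => hs i ((pos_iff_ne_zero
    (a := v i)).2 fun h0 => hi ?_)]
  · exact tsum_congr fun j => by rw [hv]
  · simp only [h0, hF]

theorem frobeniusNorm_eq_bigLambda [CompleteSpace H] (h : IsDiagonal T b v) :
    frobeniusNorm T = bigLambda T 1 := by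
  rw [frobeniusNorm_eq b, bigLambda]
  congr 1
  have := h.tsum_eigenSeq (F := fun c => (c : ℝ≥0∞) ^ 2) (by simp)
  calc ∑' i, ‖T (b i)‖ₑ ^ 2 = ∑' i, (v i : ℝ≥0∞) ^ 2 := by
        refine tsum_congr fun i => ?_
        rw [h.apply_basis, enorm_smul, ← ofReal_norm (b i), b.orthonormal.1 i]
        simp
    _ = _ := this.symm
    _ = _ := by
        refine tsum_congr fun j => ?_
        rw [← coe_eigenSeq, ENNReal.ofReal_coe_nnreal]

theorem eigenSeq_zero_le (h : IsDiagonal T b v) : (eigenSeq T 0 : ℝ≥0∞) ≤ ‖T‖ₑ := by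
  rcases eq_zero_or_pos (eigenSeq T 0) with h0 | h0
  · simp [h0]
  obtain ⟨e, he, hv, hs⟩ := h.exists_rearrangement
  have := T.le_opNorm (b (e ⟨0, h0⟩))
  rw [h.apply_basis, norm_smul, b.orthonormal.1, mul_one, mul_one, NNReal.norm_eq, hv] at this
  rw [enorm_eq_nnnorm, ENNReal.coe_le_coe]
  exact this

theorem summable_eigenSeq (h : IsDiagonal T b v) : Summable (eigenSeq T) := by
  rw [← ENNReal.tsum_coe_ne_top_iff_summable, h.tsum_eigenSeq (F := fun c => (c : ℝ≥0∞)) (by simp)]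
  exact ENNReal.tsum_coe_ne_top_iff_summable.2 h.summable

/-- Transports truncations of the ordered spectrum to finite sets of basis indices. Zero eigenvalues
are dropped, since they contribute nothing to a centred sum. -/
theorem sqLaw_range_eigenSeq (h : IsDiagonal T b v) :
    ∃ R : ℕ → Finset ι, (∀ n, sqLaw (Finset.range n) (fun _ => 0) (eigenSeq T) =
      sqLaw (R n) (fun _ => 0) v) ∧ ∀ i, 0 < v i → ∀ᶠ n in atTop, i ∈ R n := by
  classical
  obtain ⟨e, he, hv, hs⟩ := h.exists_rearrangement
  refine ⟨fun n => ((Finset.range n).subtype fun j => 0 < eigenSeq T j).map ⟨e, he⟩,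
    fun n => ?_, fun i hi => ?_⟩
  · rw [sqLaw_map]
    have e1 : v ∘ (⟨e, he⟩ : {j // 0 < eigenSeq T j} ↪ ι) =
        eigenSeq T ∘ Function.Embedding.subtype _ := funext fun j => hv j
    have e2 := sqLaw_map (Function.Embedding.subtype fun j => 0 < eigenSeq T j)
      ((Finset.range n).subtype fun j => 0 < eigenSeq T j) (fun _ => 0) (eigenSeq T)
    have e3 := sqLaw_union_of_zero (s := (Finset.range n).filter fun j => 0 < eigenSeq T j)
      (u := (Finset.range n).filter fun j => ¬ 0 < eigenSeq T j) (m := fun _ => 0)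
      (v := eigenSeq T) (fun _ _ => rfl) fun j hj => by
        simpa using (Finset.mem_filter.1 hj).2
    rw [Finset.subtype_map] at e2
    rw [Finset.filter_union_filter_not_eq] at e3
    rw [e3, e2, e1]
    rfl
  · obtain ⟨j, rfl⟩ := hs i hi
    filter_upwards [eventually_gt_atTop (j : ℕ)] with n hn
    simp only [Finset.mem_map, Finset.mem_subtype, Finset.mem_range]
    exact ⟨j, hn, rfl⟩

end IsDiagonal

end Eigenvalue

/-! ### Norms of Gaussian elements as limits of sums of squares -/

section Gaussian

variable {Ω H : Type*} [MeasurableSpace Ω] {P : Measure Ω}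
  [NormedAddCommGroup H] [InnerProductSpace ℝ H] [CompleteSpace H]
  [SecondCountableTopology H] [MeasurableSpace H] [BorelSpace H] {ξ : Ω → H} {ι : Type*}

theorem memLp_id_map (hξ : HasGaussianLaw ξ P) : MemLp id 2 (P.map ξ) :=
  (memLp_map_measure_iff aestronglyMeasurable_id hξ.aemeasurable).2 hξ.memLp_two

theorem integral_inner_mul_inner (hξ : HasGaussianLaw ξ P) (x y : H) :
    ∫ ω, inner ℝ x (ξ ω) * inner ℝ y (ξ ω) ∂P = inner ℝ (covarianceOperator (P.map ξ) x) y := by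
  rw [covarianceOperator_inner (memLp_id_map hξ), integral_map hξ.aemeasurable (by fun_prop)]

theorem integral_inner_eq_zero (hξ : HasGaussianLaw ξ P) (h0 : ∫ ω, ξ ω ∂P = 0) (x : H) :
    ∫ ω, inner ℝ x (ξ ω) ∂P = 0 := by
  rw [integral_inner hξ.integrable, h0, inner_zero_right]

theorem covariance_inner_inner (hξ : HasGaussianLaw ξ P) (h0 : ∫ ω, ξ ω ∂P = 0) (x y : H) :
    covariance (fun ω => inner ℝ x (ξ ω)) (fun ω => inner ℝ y (ξ ω)) P =
      inner ℝ (covarianceOperator (P.map ξ) x) y := by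
  rw [covariance, ← integral_inner_mul_inner hξ]
  simp only [integral_inner_eq_zero hξ h0, sub_zero]

theorem exists_isDiagonal_covarianceOperator {Ω : Type*} {H : Type u} [MeasurableSpace Ω]
    {P : Measure Ω} [IsProbabilityMeasure P] [NormedAddCommGroup H] [InnerProductSpace ℝ H]
    [CompleteSpace H] [SecondCountableTopology H] [MeasurableSpace H] [BorelSpace H] {ξ : Ω → H}
    (hξ : HasGaussianLaw ξ P) :
    ∃ (ι : Type u) (b : HilbertBasis ι ℝ H) (v : ι → ℝ≥0),
      IsDiagonal (covarianceOperator (P.map ξ)) b v := by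
  have : IsProbabilityMeasure (P.map ξ) := isProbabilityMeasure_map hξ.aemeasurable
  obtain ⟨ι, b, v, h⟩ := exists_hilbertBasis_eigenvectors
    (isCompactOperator_covarianceOperator (memLp_id_map hξ)) isPositive_covarianceOperator
  refine ⟨ι, b, v, h, isPositive_covarianceOperator.isSymmetric, ?_⟩
  have : Countable ι := countable_of_orthonormal b.orthonormal
  -- The trace is the second moment: by Parseval the eigenvalues sum to E‖ξ‖², finite for a Gaussian
  -- element.
  rw [← ENNReal.tsum_coe_ne_top_iff_summable]
  have hv (i : ι) : (v i : ℝ≥0∞) = ∫⁻ ω, ‖(inner ℝ (b i) (ξ ω) : ℝ)‖ₑ ^ 2 ∂P := by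
    have h1 := integral_inner_mul_inner hξ (b i) (b i)
    rw [h, inner_smul_left, real_inner_self_eq_norm_sq, b.orthonormal.1 i] at h1
    have h2 : (v i : ℝ) = ∫ ω, (inner ℝ (b i) (ξ ω) : ℝ) ^ 2 ∂P := by
      simp_rw [sq, h1]
      simp
    have hi : Integrable (fun ω => (inner ℝ (b i) (ξ ω) : ℝ) ^ 2) P :=
      (hξ.memLp_two.const_inner (b i)).integrable_sq
    rw [← ENNReal.ofReal_coe_nnreal, h2,
      ofReal_integral_eq_lintegral_ofReal hi (ae_of_all _ fun ω => sq_nonneg _)]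
    refine lintegral_congr fun ω => ?_
    rw [← ofReal_norm, ← ENNReal.ofReal_pow (norm_nonneg _), Real.norm_eq_abs, sq_abs]
  simp_rw [hv]
  have hm : AEMeasurable ξ P := hξ.aemeasurable
  rw [← lintegral_tsum fun i => by fun_prop]
  simp_rw [← parseval_enorm b]
  have := hξ.memLp_two.eLpNorm_lt_top
  rw [eLpNorm_lt_top_iff_lintegral_rpow_enorm_lt_top two_ne_zero ENNReal.ofNat_ne_top] at this
  simpa using this.ne

variable [IsProbabilityMeasure P]

/-- The law of finitely many squared coordinates of a shifted Gaussian element. -/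
theorem map_sum_sq_inner_eq_sqLaw (hξ : HasGaussianLaw ξ P) (h0 : ∫ ω, ξ ω ∂P = 0)
    {b : HilbertBasis ι ℝ H} {v : ι → ℝ≥0} (h : IsDiagonal (covarianceOperator (P.map ξ)) b v)
    (a : H) (s : Finset ι) :
    P.map (fun ω => ∑ i ∈ s, (inner ℝ (b i) (ξ ω - a) : ℝ) ^ 2) =
      sqLaw s (fun i => -inner ℝ (b i) a) v := by
  have hm : AEMeasurable ξ P := hξ.aemeasurable
  have hmi (i : ι) : AEMeasurable (fun ω => (inner ℝ (b i) (ξ ω - a) : ℝ)) P := by fun_prop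
  have hcov (i j : ι) : covariance (fun ω => inner ℝ (b i) (ξ ω)) (fun ω => inner ℝ (b j) (ξ ω)) P =
      v i * inner ℝ (b i) (b j) := by
    rw [covariance_inner_inner hξ h0, h.apply_basis, inner_smul_left]
    rfl
  -- Coordinates in an eigenbasis are jointly Gaussian and uncorrelated, hence independent.
  have hind : iIndepFun (fun (i : s) ω => (inner ℝ (b i) (ξ ω) : ℝ)) P := by
    refine HasGaussianLaw.iIndepFun_of_covariance_eq_zero
      (hξ.map_fun (ContinuousLinearMap.pi fun i : s => innerSL ℝ (b i))) fun i j hij => ?_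
    refine (hcov i j).trans ?_
    rw [b.orthonormal.2 (fun h => hij (Subtype.ext h)), mul_zero]
  refine ext_of_charFun (funext fun t => ?_)
  rw [charFun_sqLaw]
  refine charFun_map_sum_sq s ?_ (fun i _ => hmi i) (fun i _ => ?_) t
  · have := hind.comp (fun (i : s) y => y - inner ℝ (b i) a) fun i => by fun_prop
    convert this using 2 with i
    ext ω
    simp [inner_sub_right]
  · have hg := (hξ.map_fun (innerSL ℝ (b i))).map_eq_gaussianReal
    have hvar : Var[fun ω => (inner ℝ (b i) (ξ ω) : ℝ); P] = v i := by
      rw [← covariance_self (by fun_prop), hcov, real_inner_self_eq_norm_sq, b.orthonormal.1 i]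
      simp
    simp only [innerSL_apply_apply, integral_inner_eq_zero hξ h0, hvar, Real.toNNReal_coe] at hg
    have e : (fun ω => (inner ℝ (b i) (ξ ω - a) : ℝ)) =
        (fun y => y + -inner ℝ (b i) a) ∘ fun ω => (inner ℝ (b i) (ξ ω) : ℝ) := by
      ext ω
      rw [inner_sub_right, sub_eq_add_neg]
      rfl
    rw [e, ← AEMeasurable.map_map_of_aemeasurable (by fun_prop) (by fun_prop), hg,
      gaussianReal_map_add_const, zero_add]

theorem sqLaw_Iic_antitone (m : ι → ℝ) (v : ι → ℝ≥0) (x : ℝ) :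
    Antitone fun s : Finset ι => sqLaw s m v (Iic x) := by
  intro s t hst
  simp only [sqLaw]
  rw [Measure.map_apply (by fun_prop) measurableSet_Iic,
    Measure.map_apply (by fun_prop) measurableSet_Iic]
  exact measure_mono fun y hy =>
    (Finset.sum_le_sum_of_subset_of_nonneg hst fun i _ _ => sq_nonneg (y i)).trans hy

/-- Continuity from above: the ball is the decreasing intersection, over finite index sets, of the
events that the partial sum is at most x². -/
theorem tendsto_sqLaw_Iic (hξ : HasGaussianLaw ξ P) (h0 : ∫ ω, ξ ω ∂P = 0)
    {b : HilbertBasis ι ℝ H} {v : ι → ℝ≥0} (h : IsDiagonal (covarianceOperator (P.map ξ)) b v)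
    (a : H) {x : ℝ} (hx : 0 ≤ x) :
    Tendsto (fun s : Finset ι => sqLaw s (fun i => -inner ℝ (b i) a) v (Iic (x ^ 2))) atTop
      (𝓝 (P {ω | ‖ξ ω - a‖ ≤ x})) := by
  have : Countable ι := countable_of_orthonormal b.orthonormal
  have hm : AEMeasurable ξ P := hξ.aemeasurable
  have hms (s : Finset ι) : AEMeasurable (fun ω => ∑ i ∈ s, (inner ℝ (b i) (ξ ω - a) : ℝ) ^ 2) P :=
    Finset.aemeasurable_fun_sum _ fun i _ => by fun_prop
  have hset : {ω | ‖ξ ω - a‖ ≤ x} =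
      ⋂ s : Finset ι, (fun ω => ∑ i ∈ s, (inner ℝ (b i) (ξ ω - a) : ℝ) ^ 2) ⁻¹' Iic (x ^ 2) := by
    ext ω
    have hsum : HasSum (fun i => (inner ℝ (b i) (ξ ω - a) : ℝ) ^ 2) (‖ξ ω - a‖ ^ 2) := by
      have := b.hasSum_inner_mul_inner (ξ ω - a) (ξ ω - a)
      rw [real_inner_self_eq_norm_sq] at this
      refine this.congr_fun fun i => ?_
      rw [real_inner_comm, sq]
    simp only [mem_iInter, mem_preimage, mem_Iic, mem_ofPred_eq]
    rw [← pow_le_pow_iff_left₀ (norm_nonneg _) hx two_ne_zero]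
    exact ⟨fun h s => (sum_le_hasSum s (fun i _ => sq_nonneg _) hsum).trans h,
      fun h => le_of_tendsto' hsum h⟩
  rw [hset]
  have := tendsto_measure_iInter_atTop (μ := P)
    (s := fun s : Finset ι =>
      (fun ω => ∑ i ∈ s, (inner ℝ (b i) (ξ ω - a) : ℝ) ^ 2) ⁻¹' Iic (x ^ 2))
    (fun s => (hms s).nullMeasurableSet_preimage measurableSet_Iic)
    (fun s t hst ω hω => (Finset.sum_le_sum_of_subset_of_nonneg
      (f := fun i => (inner ℝ (b i) (ξ ω - a) : ℝ) ^ 2) hst fun i _ _ => sq_nonneg _).trans hω)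
    ⟨∅, measure_ne_top _ _⟩
  refine this.congr fun s => ?_
  rw [← map_sum_sq_inner_eq_sqLaw hξ h0 h, Measure.map_apply_of_aemeasurable (hms s)
    measurableSet_Iic]
  rfl

theorem tendsto_sqLaw_range_Iic (hξ : HasGaussianLaw ξ P) (h0 : ∫ ω, ξ ω ∂P = 0)
    {b : HilbertBasis ι ℝ H} {v : ι → ℝ≥0} (h : IsDiagonal (covarianceOperator (P.map ξ)) b v)
    {x : ℝ} (hx : 0 ≤ x) :
    Tendsto (fun n => sqLaw (Finset.range n) (fun _ => 0) (eigenSeq (covarianceOperator (P.map ξ)))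
      (Iic (x ^ 2))) atTop (𝓝 (P {ω | ‖ξ ω‖ ≤ x})) := by
  classical
  have hlim := tendsto_sqLaw_Iic hξ h0 h 0 hx
  simp only [inner_zero_right, neg_zero, sub_zero] at hlim
  obtain ⟨R, hR, hR'⟩ := h.sqLaw_range_eigenSeq
  simp_rw [hR]
  have hanti := sqLaw_Iic_antitone (fun _ : ι => 0) v (x ^ 2)
  -- The truncations need not follow the net of all finite sets. They lie above the limit by
  -- monotonicity, and below the value at any given finite set once they contain its indices of
  -- positive variance.
  refine tendsto_order.2 ⟨fun c hc => Eventually.of_forall fun n => ?_, fun c hc => ?_⟩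
  · exact hc.trans_le (hanti.le_of_tendsto hlim _)
  · obtain ⟨s, hs⟩ := (hlim.eventually (gt_mem_nhds hc)).exists
    have e := sqLaw_union_of_zero (s := s.filter fun i => 0 < v i)
      (u := s.filter fun i => ¬ 0 < v i) (m := fun _ => 0) (v := v) (fun _ _ => rfl) fun j hj => by
        simpa using (Finset.mem_filter.1 hj).2
    rw [Finset.filter_union_filter_not_eq] at e
    have hev : ∀ᶠ n in atTop, ∀ i ∈ s.filter fun i => 0 < v i, i ∈ R n :=
      (Filter.eventually_all_finset _).2 fun i hi => hR' i (Finset.mem_filter.1 hi).2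
    filter_upwards [hev] with n hn
    refine lt_of_le_of_lt (hanti (show _ ≤ R n from hn)) ?_
    rw [e] at hs
    exact hs

theorem measure_norm_sub_le (hξ : HasGaussianLaw ξ P) (h0 : ∫ ω, ξ ω ∂P = 0)
    {b : HilbertBasis ι ℝ H} {v : ι → ℝ≥0} (h : IsDiagonal (covarianceOperator (P.map ξ)) b v)
    (a : H) {x : ℝ} (hx : 0 ≤ x) : P {ω | ‖ξ ω - a‖ ≤ x} ≤ P {ω | ‖ξ ω‖ ≤ x} := by
  have hlim := tendsto_sqLaw_Iic hξ h0 h 0 hx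
  simp only [inner_zero_right, neg_zero, sub_zero] at hlim
  exact le_of_tendsto_of_tendsto' (tendsto_sqLaw_Iic hξ h0 h a hx) hlim fun s =>
    (((Dom.sqLaw_shift s _ v).apply (conc_top _)).2 _).1

/-- One truncation with bounded concentration is enough: each larger finite sum adds an independent
term and so inherits the bound M. -/
theorem measure_norm_le_add (hξ : HasGaussianLaw ξ P) (h0 : ∫ ω, ξ ω ∂P = 0)
    {b : HilbertBasis ι ℝ H} {v : ι → ℝ≥0} (h : IsDiagonal (covarianceOperator (P.map ξ)) b v)
    (a : H) {x : ℝ} (hx : 0 ≤ x) {M : ℝ≥0∞} {n : ℕ} (hM : Conc (sqLaw (Finset.range n) (fun _ => 0)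
      (eigenSeq (covarianceOperator (P.map ξ)))) M) :
    P {ω | ‖ξ ω‖ ≤ x} ≤ P {ω | ‖ξ ω - a‖ ≤ x} + M * ‖a‖ₑ ^ 2 := by
  classical
  have hlim := tendsto_sqLaw_Iic hξ h0 h 0 hx
  simp only [inner_zero_right, neg_zero, sub_zero] at hlim
  obtain ⟨R, hR, -⟩ := h.sqLaw_range_eigenSeq
  rw [hR] at hM
  refine le_of_tendsto_of_tendsto hlim ((tendsto_sqLaw_Iic hξ h0 h a hx).add_const _) ?_
  filter_upwards [eventually_ge_atTop (R n)] with s hs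
  have hMs : Conc (sqLaw s (fun _ => 0) v) M := by
    have := sqLaw_disjUnion (Finset.disjoint_sdiff (s := R n) (t := s)) (fun _ => 0) v
    rw [Finset.disjUnion_eq_union, Finset.union_sdiff_of_subset hs] at this
    rw [this]
    exact hM.conv _
  refine (((Dom.sqLaw_shift s (fun i => -inner ℝ (b i) a) v).apply hMs).2 _).2.trans ?_
  gcongr
  rw [parseval_enorm b]
  refine le_trans (le_of_eq (Finset.sum_congr rfl fun i _ => ?_)) (ENNReal.sum_le_tsum s)
  rw [neg_sq, ← ofReal_norm, ← ENNReal.ofReal_pow (norm_nonneg _), Real.norm_eq_abs, sq_abs]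

end Gaussian

/-! ### From concentration constants to the two estimates -/

section Comparison

/-- The constant of the comparison theorem. -/
def compConst : ℝ≥0 := concConst.toNNReal

theorem coe_compConst : (compConst : ℝ≥0∞) = ENNReal.ofReal concConst := rfl

section bigLambda

variable {H : Type*} [NormedAddCommGroup H] [InnerProductSpace ℝ H] {ι : Type*}
  {T : H →L[ℝ] H} {b : HilbertBasis ι ℝ H} {v : ι → ℝ≥0}

theorem IsDiagonal.summable_sq (h : IsDiagonal T b v) :
    Summable fun j => (eigenSeq T j : ℝ) ^ 2 := by
  refine Summable.of_nonneg_of_le (fun j => sq_nonneg _) (fun j => ?_)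
    ((NNReal.summable_coe.2 h.summable_eigenSeq).mul_left (eigenSeq T 0 : ℝ))
  rw [sq]
  gcongr
  exact_mod_cast h.antitone_eigenSeq (Nat.zero_le j)

theorem tsum_ofReal_sq_rpow {l : ℕ → ℝ} {s : ℝ} (hl : ∀ j, 0 ≤ l j)
    (h : HasSum (fun j => l j ^ 2) s) :
    (∑' j, ENNReal.ofReal (l j) ^ 2) ^ (1 / 2 : ℝ) = ENNReal.ofReal (√s) := by
  have hs : 0 ≤ s := h.nonneg fun j => sq_nonneg _
  simp_rw [← ENNReal.ofReal_pow (hl _)]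
  rw [← ENNReal.ofReal_tsum_of_nonneg (fun j => sq_nonneg _) h.summable, h.tsum_eq,
    ENNReal.ofReal_rpow_of_nonneg hs (by norm_num), Real.sqrt_eq_rpow]

theorem IsDiagonal.exists_hasSum_sq (h : IsDiagonal T b v) :
    ∃ s₁ s₂ : ℝ, HasSum (fun j => (eigenSeq T j : ℝ) ^ 2) s₁ ∧
      HasSum (fun j => (eigenSeq T (j + 1) : ℝ) ^ 2) s₂ ∧
      s₁ = (eigenSeq T 0 : ℝ) ^ 2 + s₂ ∧ 0 ≤ s₂ ∧
      bigLambda T 1 = ENNReal.ofReal (√s₁) ∧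
      (bigLambda T 1 * bigLambda T 2) ^ (1 / 2 : ℝ) = ENNReal.ofReal (√(√s₁ * √s₂)) := by
  have h1 := h.summable_sq
  have h2 := (summable_nat_add_iff 1).2 h1
  have e1 : bigLambda T 1 = ENNReal.ofReal (√(∑' j, (eigenSeq T j : ℝ) ^ 2)) :=
    tsum_ofReal_sq_rpow (fun j => eigenvalue_nonneg T _) h1.hasSum
  have e2 : bigLambda T 2 = ENNReal.ofReal (√(∑' j, (eigenSeq T (j + 1) : ℝ) ^ 2)) := by
    rw [← tsum_ofReal_sq_rpow (fun j => (eigenSeq T (j + 1)).coe_nonneg) h2.hasSum]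
    simp_rw [coe_eigenSeq, bigLambda]
    congr! 6 with j
    lia
  refine ⟨_, _, h1.hasSum, h2.hasSum, h1.tsum_eq_zero_add, tsum_nonneg fun j => sq_nonneg _, e1, ?_⟩
  rw [e1, e2, ← ENNReal.ofReal_mul (by positivity),
    ENNReal.ofReal_rpow_of_nonneg (by positivity) (by norm_num), ← Real.sqrt_eq_rpow]

theorem IsDiagonal.eventually_conc (h : IsDiagonal T b v) :
    ∀ᶠ n in atTop, Conc (sqLaw (Finset.range n) (fun _ => 0) (eigenSeq T))
      (compConst * (1 / (bigLambda T 1 * bigLambda T 2) ^ (1 / 2 : ℝ))) := by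
  obtain ⟨s₁, s₂, h1, h2, hs, hs2, -, e⟩ := h.exists_hasSum_sq
  rw [e]
  rcases hs2.eq_or_lt with h0 | h0
  -- If Λ₂ = 0 the claimed constant is 1/0 = ∞ and nothing has to be proved.
  · refine Eventually.of_forall fun n => (conc_top _).mono ?_
    rw [← h0, Real.sqrt_zero, mul_zero, Real.sqrt_zero, ENNReal.ofReal_zero, coe_compConst,
      ENNReal.div_zero one_ne_zero, ENNReal.mul_top (by simpa using concConst_pos)]
  · filter_upwards [eventually_conc_sqLaw h.antitone_eigenSeq h1 h2 h0] with n hn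
    refine hn.mono (le_of_eq ?_)
    have : 0 < s₁ := by rw [hs]; positivity
    rw [ENNReal.ofReal_div_of_pos (by positivity), coe_compConst, mul_one_div]

/-- The hypothesis gives λ₁² ≤ Λ₁²/3, so Λ₂² ≥ (2/3)Λ₁²; the weaker Λ₂ ≥ Λ₁/4 already yields the
factor 2. -/
theorem IsDiagonal.one_div_le_of_frobeniusNorm [CompleteSpace H] (h : IsDiagonal T b v)
    (hF : 3 * ‖T‖ₑ ^ 2 ≤ frobeniusNorm T ^ 2) :
    1 / (bigLambda T 1 * bigLambda T 2) ^ (1 / 2 : ℝ) ≤ 2 * (1 / frobeniusNorm T) := by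
  rw [h.frobeniusNorm_eq_bigLambda] at hF ⊢
  obtain ⟨s₁, s₂, h1, h2, hs, hs2, e1, e⟩ := h.exists_hasSum_sq
  have hs1 : 0 ≤ s₁ := by rw [hs]; positivity
  have h3 : 3 * (eigenSeq T 0 : ℝ) ^ 2 ≤ s₁ := by
    have : 3 * (eigenSeq T 0 : ℝ≥0∞) ^ 2 ≤ ENNReal.ofReal s₁ := by
      refine le_trans (by gcongr; exact h.eigenSeq_zero_le) (hF.trans_eq ?_)
      rw [e1, ← ENNReal.ofReal_pow (by positivity), Real.sq_sqrt hs1]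
    rw [← ENNReal.ofReal_le_ofReal_iff hs1]
    refine le_trans (le_of_eq ?_) this
    rw [ENNReal.ofReal_mul (by norm_num), ENNReal.ofReal_pow (by positivity),
      ENNReal.ofReal_coe_nnreal]
    norm_num
  have h4 : √s₁ ≤ 2 * √(√s₁ * √s₂) := by
    have h5 : √s₁ / 4 ≤ √s₂ := by
      refine Real.le_sqrt_of_sq_le ?_
      rw [div_pow, Real.sq_sqrt hs1]
      linarith
    have h6 : √s₁ / 2 ≤ √(√s₁ * √s₂) := by
      refine Real.le_sqrt_of_sq_le ?_
      calc (√s₁ / 2) ^ 2 = √s₁ * (√s₁ / 4) := by ring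
        _ ≤ _ := by gcongr
    linarith
  have h7 : bigLambda T 1 ≤ 2 * (bigLambda T 1 * bigLambda T 2) ^ (1 / 2 : ℝ) := by
    rw [e, e1]
    calc ENNReal.ofReal (√s₁) ≤ ENNReal.ofReal (2 * √(√s₁ * √s₂)) := ENNReal.ofReal_le_ofReal h4
      _ = _ := by rw [ENNReal.ofReal_mul (by norm_num)]; norm_num
  generalize (bigLambda T 1 * bigLambda T 2) ^ (1 / 2 : ℝ) = K at h7
  have h8 := ENNReal.inv_le_inv.2 h7
  rw [ENNReal.mul_inv (Or.inl two_ne_zero) (Or.inl ENNReal.ofNat_ne_top)] at h8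
  rw [one_div, one_div]
  calc K⁻¹ = 2 * (2⁻¹ * K⁻¹) := by
        rw [← mul_assoc, ENNReal.mul_inv_cancel two_ne_zero ENNReal.ofNat_ne_top, one_mul]
    _ ≤ _ := by gcongr

theorem sum_tsub_le_eigenvalueDist (S T : H →L[ℝ] H) (s : Finset ℕ) :
    ∑ j ∈ s, ((eigenSeq T j - eigenSeq S j : ℝ≥0) : ℝ≥0∞) ≤ eigenvalueDist S T := by
  refine le_trans (Finset.sum_le_sum fun j _ => ?_) (ENNReal.sum_le_tsum s)
  rw [← coe_eigenSeq, ← coe_eigenSeq, ← ENNReal.ofReal_coe_nnreal]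
  refine ENNReal.ofReal_le_ofReal ?_
  rw [NNReal.coe_sub_def, abs_sub_comm]
  exact max_le (le_abs_self _) (abs_nonneg _)

theorem eigenvalueDist_comm (S T : H →L[ℝ] H) : eigenvalueDist S T = eigenvalueDist T S := by
  simp_rw [eigenvalueDist, abs_sub_comm]

end bigLambda

variable {Ω H : Type*} [MeasurableSpace Ω] {P : Measure Ω} [IsProbabilityMeasure P]
  [NormedAddCommGroup H] [InnerProductSpace ℝ H] [CompleteSpace H]
  [SecondCountableTopology H] [MeasurableSpace H] [BorelSpace H] {ξ η : Ω → H}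
  {ι κ : Type*} {b : HilbertBasis ι ℝ H} {v : ι → ℝ≥0} {d : HilbertBasis κ ℝ H} {w : κ → ℝ≥0}

theorem measure_norm_le_add_eigenvalueDist (hξ : HasGaussianLaw ξ P) (hη : HasGaussianLaw η P)
    (h0 : ∫ ω, ξ ω ∂P = 0) (h0' : ∫ ω, η ω ∂P = 0)
    (h : IsDiagonal (covarianceOperator (P.map ξ)) b v)
    (h' : IsDiagonal (covarianceOperator (P.map η)) d w) {x : ℝ} (hx : 0 ≤ x) {M : ℝ≥0∞}
    (hM : ∀ᶠ n in atTop, Conc (sqLaw (Finset.range n) (fun _ => 0)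
      (eigenSeq (covarianceOperator (P.map ξ)))) M) :
    P {ω | ‖ξ ω‖ ≤ x} ≤ P {ω | ‖η ω‖ ≤ x} +
      M * eigenvalueDist (covarianceOperator (P.map ξ)) (covarianceOperator (P.map η)) := by
  refine le_of_tendsto_of_tendsto (tendsto_sqLaw_range_Iic hξ h0 h hx)
    ((tendsto_sqLaw_range_Iic hη h0' h' hx).add_const _) ?_
  filter_upwards [hM] with n hn
  refine (sqLaw_Iic_le _ _ (eigenSeq (covarianceOperator (P.map η))) hn).trans ?_
  gcongr
  exact sum_tsub_le_eigenvalueDist _ _ _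

theorem ofReal_abs_toReal_sub_le {p q R : ℝ≥0∞} (hp : p ≠ ⊤) (hq : q ≠ ⊤) (h1 : p ≤ q + R)
    (h2 : q ≤ p + R) : ENNReal.ofReal |p.toReal - q.toReal| ≤ R := by
  rcases eq_or_ne R ⊤ with rfl | hR
  · exact le_top
  rw [ENNReal.ofReal_le_iff_le_toReal hR, abs_le]
  have h1' := ENNReal.toReal_mono (by finiteness) h1
  have h2' := ENNReal.toReal_mono (by finiteness) h2
  rw [ENNReal.toReal_add hq hR] at h1'
  rw [ENNReal.toReal_add hp hR] at h2'
  constructor <;> linarith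

theorem iSup_ofReal_abs_measure_sub_le (hξ : HasGaussianLaw ξ P) (hη : HasGaussianLaw η P)
    (h0 : ∫ ω, ξ ω ∂P = 0) (h0' : ∫ ω, η ω ∂P = 0)
    (h : IsDiagonal (covarianceOperator (P.map ξ)) b v)
    (h' : IsDiagonal (covarianceOperator (P.map η)) d w) {M N : ℝ≥0∞}
    (hM : ∀ᶠ n in atTop, Conc (sqLaw (Finset.range n) (fun _ => 0)
      (eigenSeq (covarianceOperator (P.map ξ)))) M)
    (hN : ∀ᶠ n in atTop, Conc (sqLaw (Finset.range n) (fun _ => 0)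
      (eigenSeq (covarianceOperator (P.map η)))) N) (a : H) :
    (⨆ (x : ℝ) (_ : 0 < x),
      ENNReal.ofReal |P.real {ω | ‖ξ ω - a‖ ≤ x} - P.real {ω | ‖η ω‖ ≤ x}|) ≤
      (M + N) * (eigenvalueDist (covarianceOperator (P.map ξ)) (covarianceOperator (P.map η)) +
        ‖a‖ₑ ^ 2) := by
  set D := eigenvalueDist (covarianceOperator (P.map ξ)) (covarianceOperator (P.map η)) with hD
  refine iSup₂_le fun x hx => ofReal_abs_toReal_sub_le (measure_ne_top _ _) (measure_ne_top _ _)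
    ?_ ?_
  · calc P {ω | ‖ξ ω - a‖ ≤ x} ≤ P {ω | ‖ξ ω‖ ≤ x} := measure_norm_sub_le hξ h0 h a hx.le
      _ ≤ P {ω | ‖η ω‖ ≤ x} + M * D :=
        measure_norm_le_add_eigenvalueDist hξ hη h0 h0' h h' hx.le hM
      _ ≤ _ := by
        gcongr
        · exact le_self_add
        · exact le_self_add
  · obtain ⟨n, hn⟩ := hM.exists
    have h1 := measure_norm_le_add_eigenvalueDist hη hξ h0' h0 h' h hx.le hN
    rw [eigenvalueDist_comm, ← hD] at h1
    calc P {ω | ‖η ω‖ ≤ x} ≤ P {ω | ‖ξ ω‖ ≤ x} + N * D := h1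
      _ ≤ P {ω | ‖ξ ω - a‖ ≤ x} + M * ‖a‖ₑ ^ 2 + N * D := by
        gcongr
        exact measure_norm_le_add hξ h0 h a hx.le hn
      _ = P {ω | ‖ξ ω - a‖ ≤ x} + (N * D + M * ‖a‖ₑ ^ 2) := by ring
      _ ≤ _ := by
        rw [mul_add (M + N)]
        gcongr
        · exact le_add_self
        · exact le_self_add

end Comparison

end GaussianComparison

end

theorem mainTheorem4 :
    ∃ C : ℝ≥0,
      ∀ {Ω H : Type*} [MeasurableSpace Ω] (P : Measure Ω) [IsProbabilityMeasure P]
        [NormedAddCommGroup H] [InnerProductSpace ℝ H] [CompleteSpace H]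
        [SecondCountableTopology H] [MeasurableSpace H] [BorelSpace H]
        (ξ η : Ω → H) (_ : HasGaussianLaw ξ P) (_ : HasGaussianLaw η P)
        (_ : ∫ ω, ξ ω ∂P = 0) (_ : ∫ ω, η ω ∂P = 0)
        (Sξ Sη : H →L[ℝ] H) (_ : Sξ = covarianceOperator (P.map ξ))
        (_ : Sη = covarianceOperator (P.map η)),
        (∀ a : H,
          (⨆ (x : ℝ) (_ : 0 < x),
              ENNReal.ofReal |P.real {ω | ‖ξ ω - a‖ ≤ x} - P.real {ω | ‖η ω‖ ≤ x}|) ≤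
            C * (1 / (GaussianComparison.bigLambda Sξ 1 *
                    GaussianComparison.bigLambda Sξ 2) ^ (1 / 2 : ℝ) +
                1 / (GaussianComparison.bigLambda Sη 1 *
                    GaussianComparison.bigLambda Sη 2) ^ (1 / 2 : ℝ)) *
              (GaussianComparison.eigenvalueDist Sξ Sη + ‖a‖ₑ ^ 2)) ∧
        (3 * ‖Sξ‖ₑ ^ 2 ≤ GaussianComparison.frobeniusNorm Sξ ^ 2 →
          3 * ‖Sη‖ₑ ^ 2 ≤ GaussianComparison.frobeniusNorm Sη ^ 2 →
          ∀ a : H,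
            (⨆ (x : ℝ) (_ : 0 < x),
                ENNReal.ofReal |P.real {ω | ‖ξ ω - a‖ ≤ x} - P.real {ω | ‖η ω‖ ≤ x}|) ≤
              C * (1 / GaussianComparison.frobeniusNorm Sξ +
                  1 / GaussianComparison.frobeniusNorm Sη) *
                (GaussianComparison.eigenvalueDist Sξ Sη + ‖a‖ₑ ^ 2)) := by
  -- The factor 2 is the loss in replacing (Λ₁Λ₂)^(-1/2) by the inverse Frobenius norm in (ii); (i)
  -- holds without it.
  refine ⟨2 * GaussianComparison.compConst, ?_⟩
  intro Ω H _ P _ _ _ _ _ _ _ ξ η hξ hη h0 h0' Sξ Sη hSξ hSη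
  subst hSξ hSη
  obtain ⟨ι, b, v, h⟩ := GaussianComparison.exists_isDiagonal_covarianceOperator hξ
  obtain ⟨κ, d, w, h'⟩ := GaussianComparison.exists_isDiagonal_covarianceOperator hη
  have key (a : H) := GaussianComparison.iSup_ofReal_abs_measure_sub_le hξ hη h0 h0' h h'
    h.eventually_conc h'.eventually_conc a
  refine ⟨fun a => (key a).trans ?_, fun h3 h3' a => (key a).trans ?_⟩
  · rw [← mul_add]
    gcongr
    exact_mod_cast le_mul_of_one_le_left zero_le one_le_two
  · rw [← mul_add]
    refine mul_le_mul_left ?_ _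
    calc _ ≤ (GaussianComparison.compConst : ℝ≥0∞) *
          (2 * (1 / GaussianComparison.frobeniusNorm (covarianceOperator (P.map ξ))) +
            2 * (1 / GaussianComparison.frobeniusNorm (covarianceOperator (P.map η)))) := by
          gcongr
          · exact h.one_div_le_of_frobeniusNorm h3
          · exact h'.one_div_le_of_frobeniusNorm h3'
      _ = _ := by
          push_cast
          ring
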